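/- Let $a,b,c$ be nonnegative integers and let $r,s,t$ be integers with $0\le r\le a+2$, $0\le s\le b+2$, $0\le t\le c+2$. A plane partition contained in an $(a+2)\times(b+2)\times(c+2)$ box is an array of integers between $0$ and $c+2$ with $a+2$ rows and $b+2$ columns, whose rows (from left to right) and columns (from top to bottom) are nonincreasing. The number of plane partitions contained in an $(a+2)\times(b+2)\times(c+2)$ box having exactly $b+2-s$ entries equal to $c+2$ in the first row, exactly $r$ entries equal to $0$ in the last column, and $c+2-t$ as the bottom-left entry equals $$ \begin{aligned} &(r+1)_b\,(s+1)_c\,(t+1)_a\,(c+3-t)_b\,(a+3-r)_c\,(b+3-s)_a\; \frac{\prod_{k=0}^{a}k!\;\prod_{k=0}^{b}k!\;\prod_{k=0}^{c}k!\;\prod_{k=0}^{a+b+c+2}k!} {\prod_{k=0}^{b+c+2}k!\;\prod_{k=0}^{a+c+2}k!\;\prod_{k=0}^{a+b+2}k!}\\ &\times\Big((a+1)(b+1)(c+1)(a+2-r)(b+2-s)(c+2-t)+(a+1)(b+1)(c+1)\,r s t\\ &\qquad-(a+2-r)(b+2-s)(c+2-t)\,r s t+(a+1)(c+1)(b+2-s)(c+2-t)\,r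 s\\ &\qquad+(b+1)(a+1)(c+2-t)(a+2-r)\,s t+(c+1)(b+1)(a+2-r)(b+2-s)\,t r\Big), \end{aligned} $$ where $(x)_n=x(x+1)\cdots(x+n-1)$, with $(x)_0=1$. -/

import Mathlib

/-- A plane partition contained in an `A × B × C` box, viewed as a planar array: `A` rows and
`B` columns of nonnegative integers, each at most `C`, such that every row (read from left to
right) and every column (read from top to bottom) is nonincreasing.  Row `0` is the first (top)
row and column `0` is the first (leftmost) column. -/
@[ext]
structure PlanePartition (A B C : ℕ) where
  entry : Fin A → Fin B → ℕ
  entry_le : ∀ i j, entry i j ≤ C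
  row_antitone : ∀ i, Antitone fun j => entry i j
  col_antitone : ∀ j, Antitone fun i => entry i j

/-- There are only finitely many plane partitions in a given box, so `Nat.card` of a subtype of
`PlanePartition A B C` is the genuine number of its elements. -/
instance PlanePartition.instFinite (A B C : ℕ) : Finite (PlanePartition A B C) := by
  refine Finite.of_injective
    (fun P : PlanePartition A B C => fun i j =>
      (⟨P.entry i j, Nat.lt_succ_of_le (P.entry_le i j)⟩ : Fin (C + 1))) ?_
  intro P Q h
  ext i j
  have h2 := congrFun (congrFun h i) j
  exact congrArg Fin.val h2

/-- The rising factorial `(x)_n = x (x + 1) ⋯ (x + n - 1)`. -/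
noncomputable def risingFactorial (x : ℚ) (n : ℕ) : ℚ :=
  (ascPochhammer ℚ n).eval x

/-- The product `∏_{k = 0}^{n} k!`. -/
def prodFactorials (n : ℕ) : ℚ :=
  ∏ k ∈ Finset.range (n + 1), (Nat.factorial k : ℚ)

/-! Rotated by a half turn, a plane partition becomes a monotone chain of monotone rows, starting
from the old bottom row. The zeros of the last column constrain the first entry of every row, the
corner value constrains the last entry of the initial row, and the entries `c + 2` constrain the
final row.

Rows are added one at a time. The number of chains with a given final row is a determinant whose row
`p` depends only on the entry at position `p` (`chainCount_eq_det`). This form is preserved because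
summing an alternating form over monotone tuples is iterated summation by parts: the lower limit at
position `p + 1` contributes a copy of row `p`, hence nothing (`sum_alternating_boundedTuples`).
Pascal's rule supplies the antidifferences. Imposing the condition on the final row leaves a matrix
of `b + 3` rows with row `s` deleted (`card_planePartition_eq_det`).

The deleted row is restored by bordering with a unit column at `s`. Then `b` of the columns are
plain binomial columns and three are exceptional: the unit column, the zero column and the corner
column. Three polynomial weights of degree at most `a + c + 2` annihilate the binomial columns,
since these compute differences of order `a + c + 3` (`sum_risingFactorial_mul_shiftedChoose`).
Hence the determinant reduces to a `3 × 3` determinant times MacMahon's determinant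
(`det_mul_det_fromBlocks_of_annihilates`, `det_shiftedChoose`). The `3 × 3` entries are values of
the weights at `s` and Vandermonde-type sums. The rising factorials factor out of its columns, and
the six-term polynomial remains (`det_boundaryData_eq`). -/

/-! ### Summation of alternating forms over monotone tuples. -/

/-- The monotone tuples `μ` with `L ≤ μ p ≤ u p` for `p < s` and `μ p = u p` for `s ≤ p`. -/
def boundedTuples (n L s : ℕ) (u : Fin n → ℕ) : Finset (Fin n → ℕ) :=
  {μ ∈ Fintype.piFinset fun p : Fin n => if (p : ℕ) < s then Finset.Icc L (u p) else {u p} |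
    Monotone μ}

theorem mem_boundedTuples {n L s : ℕ} {u μ : Fin n → ℕ} :
    μ ∈ boundedTuples n L s u ↔
      (∀ p : Fin n, ((p : ℕ) < s → L ≤ μ p ∧ μ p ≤ u p) ∧ (s ≤ (p : ℕ) → μ p = u p)) ∧
        Monotone μ := by
  simp only [boundedTuples, Finset.mem_filter, Fintype.mem_piFinset]
  refine and_congr_left fun _ => forall_congr' fun p => ?_
  by_cases hp : (p : ℕ) < s
  · simp [hp]
  · simp [hp, not_lt.mp hp]

theorem Fin.monotone_cons_iff {n : ℕ} {m : ℕ} {μ : Fin n → ℕ} :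
    Monotone (Fin.cons m μ : Fin (n + 1) → ℕ) ↔ (∀ p, m ≤ μ p) ∧ Monotone μ := by
  constructor
  · intro h
    refine ⟨fun p => ?_, fun i j hij => ?_⟩
    · simpa using h (Fin.zero_le p.succ)
    · simpa using h (Fin.succ_le_succ_iff.mpr hij)
  · rintro ⟨h0, h⟩ i j hij
    induction i using Fin.cases with
    | zero =>
      induction j using Fin.cases with
      | zero => simp
      | succ j => simpa using h0 j
    | succ i =>
      induction j using Fin.cases with
      | zero => simp at hij
      | succ j => simpa using h (Fin.succ_le_succ_iff.mp hij)

/-- The first entry becomes the lower bound for the rest. Monotonicity of `u` guarantees that the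
frozen entries `μ p = u p` respect this bound automatically. -/
theorem cons_mem_boundedTuples {n L s m : ℕ} {u : Fin (n + 1) → ℕ} (hu : Monotone u)
    {μ : Fin n → ℕ} :
    (Fin.cons m μ : Fin (n + 1) → ℕ) ∈ boundedTuples (n + 1) L (s + 1) u ↔
      m ∈ Finset.Icc L (u 0) ∧ μ ∈ boundedTuples n m s (Fin.tail u) := by
  rw [mem_boundedTuples, mem_boundedTuples, Fin.monotone_cons_iff, Fin.forall_fin_succ]
  simp only [Fin.cons_zero, Fin.cons_succ, Fin.val_zero, Fin.val_succ, Finset.mem_Icc, Fin.tail,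
    Nat.add_lt_add_iff_right, Nat.add_le_add_iff_right]
  constructor
  · rintro ⟨⟨h0, h1⟩, h2, h3⟩
    refine ⟨h0.1 (by omega), fun p => ⟨fun hp => ⟨h2 p, ((h1 p).1 hp).2⟩, (h1 p).2⟩, h3⟩
  · rintro ⟨h0, h1, h3⟩
    refine ⟨⟨⟨fun _ => h0, fun h => by omega⟩, fun p => ⟨fun hp => ?_, (h1 p).2⟩⟩, fun p => ?_, h3⟩
    · have := (h1 p).1 hp
      omega
    · by_cases hp : (p : ℕ) < s
      · exact ((h1 p).1 hp).1
      · rw [(h1 p).2 (not_lt.mp hp)]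
        exact h0.2.trans (hu (Fin.zero_le _))

theorem sum_boundedTuples_succ {n L s : ℕ} {u : Fin (n + 1) → ℕ} (hu : Monotone u)
    (f : (Fin (n + 1) → ℕ) → ℚ) :
    ∑ μ ∈ boundedTuples (n + 1) L (s + 1) u, f μ =
      ∑ m ∈ Finset.Icc L (u 0), ∑ μ ∈ boundedTuples n m s (Fin.tail u), f (Fin.cons m μ) := by
  rw [Finset.sum_sigma']
  symm
  refine Finset.sum_bij' (fun x _ => (Fin.cons x.1 x.2 : Fin (n + 1) → ℕ))
    (fun μ _ => ⟨μ 0, Fin.tail μ⟩) ?_ ?_ ?_ ?_ ?_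
  · rintro ⟨m, μ⟩ h
    rw [Finset.mem_sigma] at h
    exact (cons_mem_boundedTuples hu).mpr h
  · intro μ h
    rw [Finset.mem_sigma]
    rw [← Fin.cons_self_tail μ] at h
    exact (cons_mem_boundedTuples hu).mp h
  · rintro ⟨m, μ⟩ _
    simp
  · intro μ _
    simp
  · intros
    rfl

theorem boundedTuples_eq_singleton {n L s : ℕ} {u : Fin n → ℕ} (hu : Monotone u)
    (hs : n = 0 ∨ s = 0) : boundedTuples n L s u = {u} := by
  ext μ
  rw [mem_boundedTuples, Finset.mem_singleton]
  constructor
  · rintro ⟨h, -⟩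
    funext p
    rcases hs with rfl | rfl
    · exact p.elim0
    · exact (h p).2 (Nat.zero_le _)
  · rintro rfl
    refine ⟨fun p => ⟨fun hp => ?_, fun _ => rfl⟩, hu⟩
    rcases hs with rfl | rfl
    · exact p.elim0
    · omega

/-- Summation of an alternating form over monotone tuples.  The rows `F p` and their
antidifferences `H p` are linked by `H (p + 1) = F p`, so the lower summation limits cancel. -/
theorem sum_alternating_boundedTuples {V : Type*} [AddCommGroup V] [Module ℚ V] :
    ∀ (n s L : ℕ) (g : V [⋀^Fin n]→ₗ[ℚ] ℚ) (F H : ℕ → ℕ → V) (u : Fin n → ℕ),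
      Monotone u → (∀ p, L ≤ u p) →
      (∀ p m, p < n → L ≤ m → H p (m + 1) = H p m + F p m) →
      (∀ p m, p + 1 < n → H (p + 1) m = F p m) →
      ∑ μ ∈ boundedTuples n L s u, g (fun p => F p (μ p)) =
        g fun p => if (p : ℕ) < s then
            (if (p : ℕ) = 0 then H p (u p + 1) - H p L else H p (u p + 1))
          else F p (u p) := by
  intro n
  induction n with
  | zero =>
    intro s L g F H u hu _ _ _
    rw [boundedTuples_eq_singleton hu (Or.inl rfl), Finset.sum_singleton]
    congr 1
    funext p
    exact p.elim0
  | succ n ih =>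
    intro s L g F H u hu hL hH hF
    cases s with
    | zero =>
      rw [boundedTuples_eq_singleton hu (Or.inr rfl), Finset.sum_singleton]
      simp
    | succ s =>
      rw [sum_boundedTuples_succ hu]
      set R : Fin n → V := fun p => if (p : ℕ) < s then H (p + 1) (u p.succ + 1)
        else F (p + 1) (u p.succ) with hR
      have hconst : ∀ m ∈ Finset.Icc L (u 0),
          ∑ μ ∈ boundedTuples n m s (Fin.tail u),
            g (fun p => F p ((Fin.cons m μ : Fin (n + 1) → ℕ) p)) = g (Fin.cons (F 0 m) R) := by
        intro m hm
        rw [Finset.mem_Icc] at hm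
        have hrow : ∀ μ : Fin n → ℕ,
            g (fun p => F p ((Fin.cons m μ : Fin (n + 1) → ℕ) p)) =
              g.curryLeft (F 0 m) (fun p => F (p + 1) (μ p)) := by
          intro μ
          rw [AlternatingMap.curryLeft_apply_apply]
          congr 1
          funext p
          induction p using Fin.cases with
          | zero => simp
          | succ p => simp
        simp_rw [hrow]
        rw [ih s m (g.curryLeft (F 0 m)) (fun p => F (p + 1)) (fun p => H (p + 1)) (Fin.tail u)
          (fun i j hij => hu (Fin.succ_le_succ_iff.mpr hij))
          (fun p => hm.2.trans (hu (Fin.zero_le _)))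
          (fun p k hp hk => hH _ _ (by omega) (hm.1.trans hk))
          (fun p k hp => hF _ _ (by omega)), AlternatingMap.curryLeft_apply_apply]
        cases n with
        | zero =>
          congr 1
          funext p
          induction p using Fin.cases with
          | zero => rfl
          | succ p => exact p.elim0
        | succ n =>
          cases s with
          | zero => rfl
          | succ s =>
            have h1 : (fun p : Fin (n + 1) => if (p : ℕ) < s + 1 then
                (if (p : ℕ) = 0 then H (p + 1) (Fin.tail u p + 1) - H (p + 1) m
                  else H (p + 1) (Fin.tail u p + 1)) else F (p + 1) (Fin.tail u p)) =
                Function.update R 0 (R 0 - F 0 m) := by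
              funext p
              induction p using Fin.cases with
              | zero => simp [hR, Fin.tail, ← hF 0 m (by omega)]
              | succ p => simp [hR, Fin.tail, Fin.succ_ne_zero]
            have h2 : (Matrix.vecCons (F 0 m) (Function.update R 0 (R 0 - F 0 m))) =
                Function.update (Fin.cons (F 0 m) R : Fin (n + 2) → V) 1
                  ((Fin.cons (F 0 m) R : Fin (n + 2) → V) 1 - F 0 m) := by
              change (Fin.cons (F 0 m) (Function.update R 0 (R 0 - F 0 m)) : Fin (n + 2) → V) = _
              rw [Fin.cons_update]
              rfl
            -- The lower limit of the inner sum is the outer variable `m`, and `H 1 m = F 0 m`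
            -- repeats row `0`, so the subtracted form vanishes.
            rw [h1, h2, AlternatingMap.map_update_sub, Function.update_eq_self, sub_eq_self]
            refine g.map_eq_zero_of_eq _ (i := 0) (j := 1) ?_ (by simp)
            simp
      rw [Finset.sum_congr rfl hconst]
      have hsum : ∑ m ∈ Finset.Icc L (u 0), F 0 m = H 0 (u 0 + 1) - H 0 L := by
        have : ∀ N, L ≤ N → ∑ m ∈ Finset.Ico L N, F 0 m = H 0 N - H 0 L := by
          intro N hN
          induction N, hN using Nat.le_induction with
          | base => simp
          | succ N hN ihN =>
            rw [Finset.sum_Ico_succ_top hN, ihN, hH 0 N (by omega) hN]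
            abel
        exact this (u 0 + 1) ((hL 0).trans (Nat.le_succ _))
      have hfin : (fun p : Fin (n + 1) => if (p : ℕ) < s + 1 then
          (if (p : ℕ) = 0 then H p (u p + 1) - H p L else H p (u p + 1)) else F p (u p)) =
          Fin.cons (∑ m ∈ Finset.Icc L (u 0), F 0 m) R := by
        funext p
        induction p using Fin.cases with
        | zero => simp [hsum]
        | succ p => simp [hR]
      rw [hfin]
      have hlin : ∀ x, g (Fin.cons x R) = g (Function.update (Fin.cons 0 R) 0 x) := fun x => by
        rw [Fin.update_cons_zero]
      simp_rw [hlin]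
      rw [AlternatingMap.map_update_sum]

/-! ### Plane partitions as chains of rows. -/

/-- The number of monotone chains of `k + 1` monotone rows
ending in `u`, such that the leftmost entry vanishes exactly in the rows with index `< r`, and
the rightmost entry of row `0` is `T`. -/
def chainCount (b r T : ℕ) : ℕ → (Fin (b + 2) → ℕ) → ℚ
  | 0, u => if u (Fin.last (b + 1)) = T ∧ (u 0 = 0 ↔ 0 < r) then 1 else 0
  | k + 1, u => if (u 0 = 0 ↔ k + 1 < r) then
      ∑ μ ∈ boundedTuples (b + 2) 0 (b + 2) u, chainCount b r T k μ else 0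

/-- The chains counted by `chainCount`, without the condition on the last row. -/
structure IsRowChain (b r T k : ℕ) (q : Fin (k + 1) → Fin (b + 2) → ℕ) : Prop where
  col : Monotone q
  row : ∀ i, Monotone (q i)
  zero : ∀ i, q i 0 = 0 ↔ (i : ℕ) < r
  corner : q 0 (Fin.last (b + 1)) = T

theorem Fin.monotone_snoc_iff {α : Type*} [Preorder α] {k : ℕ} {q : Fin (k + 1) → α} {u : α} :
    Monotone (Fin.snoc q u : Fin (k + 2) → α) ↔ Monotone q ∧ q (Fin.last k) ≤ u := by
  constructor
  · intro h
    refine ⟨fun i j hij => ?_, ?_⟩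
    · simpa only [Fin.snoc_castSucc] using h (Fin.castSucc_le_castSucc_iff.mpr hij)
    · simpa only [Fin.snoc_castSucc, Fin.snoc_last] using h (Fin.le_last (Fin.last k).castSucc)
  · rintro ⟨h, h1⟩ i j hij
    induction j using Fin.lastCases with
    | last =>
      induction i using Fin.lastCases with
      | last => exact le_rfl
      | cast i =>
        rw [Fin.snoc_castSucc, Fin.snoc_last]
        exact (h (Fin.le_last i)).trans h1
    | cast j =>
      induction i using Fin.lastCases with
      | last => exact absurd (Fin.le_last (Fin.castSucc j)) (by
          have := Fin.castSucc_lt_last j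
          exact fun _ => absurd (hij.trans_lt this) (lt_irrefl _))
      | cast i =>
        rw [Fin.snoc_castSucc, Fin.snoc_castSucc]
        exact h (Fin.castSucc_le_castSucc_iff.mp hij)

theorem isRowChain_snoc_iff {b r T k : ℕ} {q : Fin (k + 1) → Fin (b + 2) → ℕ}
    {u : Fin (b + 2) → ℕ} :
    IsRowChain b r T (k + 1) (Fin.snoc q u : Fin (k + 2) → Fin (b + 2) → ℕ) ↔
      IsRowChain b r T k q ∧ q (Fin.last k) ≤ u ∧ Monotone u ∧ (u 0 = 0 ↔ k + 1 < r) := by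
  have h0 : (Fin.snoc q u : Fin (k + 2) → Fin (b + 2) → ℕ) 0 = q 0 := by
    rw [← Fin.castSucc_zero, Fin.snoc_castSucc]
  constructor
  · rintro ⟨h1, h2, h3, h4⟩
    rw [Fin.monotone_snoc_iff] at h1
    refine ⟨⟨h1.1, fun i => ?_, fun i => ?_, h0 ▸ h4⟩, h1.2, ?_, ?_⟩
    · simpa only [Fin.snoc_castSucc] using h2 i.castSucc
    · simpa only [Fin.snoc_castSucc, Fin.val_castSucc] using h3 i.castSucc
    · simpa only [Fin.snoc_last] using h2 (Fin.last _)
    · simpa only [Fin.snoc_last, Fin.val_last] using h3 (Fin.last _)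
  · rintro ⟨⟨h1, h2, h3, h4⟩, h5, h6, h7⟩
    refine ⟨Fin.monotone_snoc_iff.mpr ⟨h1, h5⟩, fun i => ?_, fun i => ?_, h0.symm ▸ h4⟩
    · induction i using Fin.lastCases with
      | last => simpa only [Fin.snoc_last] using h6
      | cast i => simpa only [Fin.snoc_castSucc] using h2 i
    · induction i using Fin.lastCases with
      | last => simpa only [Fin.snoc_last, Fin.val_last] using h7
      | cast i => simpa only [Fin.snoc_castSucc, Fin.val_castSucc] using h3 i

/-- Counting by fibres. Finiteness is carried along because the ambient types of arrays are
infinite, and `Nat.card` of an infinite type is zero. -/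
theorem card_subtype_eq_sum {α β : Type*} (p : α → Prop) (f : α → β) (s : Finset β)
    (w : β → ℚ) (hs : ∀ x, p x → f x ∈ s)
    (hw : ∀ y ∈ s, Finite {x // p x ∧ f x = y} ∧ (Nat.card {x // p x ∧ f x = y} : ℚ) = w y) :
    Finite {x // p x} ∧ (Nat.card {x // p x} : ℚ) = ∑ y ∈ s, w y := by
  let e : {x // p x} ≃ Σ y : s, {x // p x ∧ f x = y} :=
    { toFun := fun x => ⟨⟨f x.1, hs x.1 x.2⟩, ⟨x.1, x.2, rfl⟩⟩
      invFun := fun z => ⟨z.2.1, z.2.2.1⟩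
      left_inv := fun x => rfl
      right_inv := by
        rintro ⟨⟨y, hy⟩, ⟨x, hx, hxy⟩⟩
        obtain rfl : f x = y := hxy
        rfl }
  have hfin : ∀ y : s, Finite {x // p x ∧ f x = y} := fun y => (hw y y.2).1
  refine ⟨Finite.of_equiv _ e.symm, ?_⟩
  rw [Nat.card_congr e, Nat.card_sigma, Nat.cast_sum, ← Finset.sum_coe_sort s w]
  exact Finset.sum_congr rfl fun y _ => (hw y y.2).2

/-- Removing the final row leaves a shorter chain whose own final row lies below `u`; sorting by
that row gives the recursion of `chainCount`. -/
theorem card_isRowChain (b r T : ℕ) : ∀ (k : ℕ) (u : Fin (b + 2) → ℕ), Monotone u →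
    Finite {q // IsRowChain b r T k q ∧ q (Fin.last k) = u} ∧
      (Nat.card {q // IsRowChain b r T k q ∧ q (Fin.last k) = u} : ℚ) = chainCount b r T k u := by
  intro k
  induction k with
  | zero =>
    intro u hu
    have hsub : Subsingleton {q // IsRowChain b r T 0 q ∧ q (Fin.last 0) = u} := by
      refine ⟨fun x y => Subtype.ext (funext fun i => ?_)⟩
      rw [show i = Fin.last 0 from Fin.ext (by rw [Fin.val_last]; omega), x.2.2, y.2.2]
    refine ⟨inferInstance, ?_⟩
    rw [chainCount]
    split_ifs with h
    · have : Nonempty {q // IsRowChain b r T 0 q ∧ q (Fin.last 0) = u} :=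
        ⟨fun _ => u, ⟨monotone_const, fun _ => hu, fun i => by simpa [Fin.eq_zero i] using h.2,
          h.1⟩, rfl⟩
      exact_mod_cast Nat.card_eq_one_iff_unique.mpr ⟨hsub, this⟩
    · have : IsEmpty {q // IsRowChain b r T 0 q ∧ q (Fin.last 0) = u} := by
        refine ⟨?_⟩
        rintro ⟨q, hq, rfl⟩
        exact h ⟨hq.corner, by simpa using hq.zero 0⟩
      rw [Nat.card_of_isEmpty, Nat.cast_zero]
  | succ k ih =>
    intro u hu
    have key := card_subtype_eq_sum
      (fun q : Fin (k + 1) → Fin (b + 2) → ℕ => IsRowChain b r T k q ∧ q (Fin.last k) ≤ u)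
      (fun q => q (Fin.last k)) (boundedTuples (b + 2) 0 (b + 2) u) (chainCount b r T k)
      (fun q hq => mem_boundedTuples.mpr
        ⟨fun p => ⟨fun _ => ⟨Nat.zero_le _, hq.2 p⟩, fun hp => absurd p.2 (not_lt.mpr hp)⟩,
          hq.1.row _⟩)
      (fun μ hμ => by
        have hle : μ ≤ u := fun p => (((mem_boundedTuples.mp hμ).1 p).1 p.2).2
        have e : {q // (IsRowChain b r T k q ∧ q (Fin.last k) ≤ u) ∧ q (Fin.last k) = μ} ≃
            {q // IsRowChain b r T k q ∧ q (Fin.last k) = μ} :=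
          Equiv.subtypeEquivRight fun q =>
            ⟨fun h => ⟨h.1.1, h.2⟩, fun h => ⟨⟨h.1, h.2.le.trans hle⟩, h.2⟩⟩
        obtain ⟨h1, h2⟩ := ih μ (mem_boundedTuples.mp hμ).2
        exact ⟨Finite.of_equiv _ e.symm, by rw [Nat.card_congr e, h2]⟩)
    rw [chainCount]
    split_ifs with h
    · let e : {q // IsRowChain b r T (k + 1) q ∧ q (Fin.last (k + 1)) = u} ≃
          {q : Fin (k + 1) → Fin (b + 2) → ℕ // IsRowChain b r T k q ∧ q (Fin.last k) ≤ u} :=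
        { toFun := fun x => ⟨Fin.init x.1, by
            obtain ⟨q, hq, rfl⟩ := x
            rw [← Fin.snoc_init_self q, isRowChain_snoc_iff] at hq
            exact ⟨hq.1, hq.2.1⟩⟩
          invFun := fun y => ⟨Fin.snoc y.1 u,
            isRowChain_snoc_iff.mpr ⟨y.2.1, y.2.2, hu, h⟩, Fin.snoc_last _ _⟩
          left_inv := by
            rintro ⟨q, hq, rfl⟩
            exact Subtype.ext (Fin.snoc_init_self q)
          right_inv := fun y => Subtype.ext (Fin.init_snoc (α := fun _ => Fin (b + 2) → ℕ) u y.1) }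
      have := key.1
      exact ⟨Finite.of_equiv _ e.symm, by rw [Nat.card_congr e, key.2]⟩
    · have : IsEmpty {q // IsRowChain b r T (k + 1) q ∧ q (Fin.last (k + 1)) = u} := by
        refine ⟨?_⟩
        rintro ⟨q, hq, rfl⟩
        rw [← Fin.snoc_init_self q, isRowChain_snoc_iff] at hq
        exact h hq.2.2.2
      exact ⟨inferInstance, by simp⟩

/-- A downward closed subset of `Fin n` is an initial segment, so its cardinality determines it.
This turns the boundary counts into pointwise conditions. -/
theorem apply_iff_lt_card_filter {n : ℕ} (p : Fin n → Prop) [DecidablePred p]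
    (hp : ∀ i j, i ≤ j → p j → p i) (j : Fin n) :
    p j ↔ (j : ℕ) < (Finset.univ.filter p).card := by
  constructor
  · intro hj
    have : Finset.Iic j ⊆ Finset.univ.filter p := fun i hi => by
      simpa using hp i j (Finset.mem_Iic.mp hi) hj
    have := Finset.card_le_card this
    rw [Fin.card_Iic] at this
    omega
  · intro h
    by_contra hj
    have : Finset.univ.filter p ⊆ Finset.Iio j := fun i hi => by
      rw [Finset.mem_Iio]
      by_contra hij
      exact hj (hp j i (not_lt.mp hij) (by simpa using hi))
    have := Finset.card_le_card this
    rw [Fin.card_Iio] at this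
    omega

theorem card_filter_eq_iff {n N : ℕ} (hN : N ≤ n) (p : Fin n → Prop) [DecidablePred p]
    (hp : ∀ i j, i ≤ j → p j → p i) :
    (Finset.univ.filter p).card = N ↔ ∀ j : Fin n, p j ↔ (j : ℕ) < N := by
  constructor
  · rintro rfl j
    exact apply_iff_lt_card_filter p hp j
  · intro h
    simp_rw [h]
    rw [Fin.card_filter_val_lt]
    omega

theorem card_filter_eq_iff_of_upward {n N : ℕ} (hN : N ≤ n) (p : Fin n → Prop) [DecidablePred p]
    (hp : ∀ i j, i ≤ j → p i → p j) :
    (Finset.univ.filter p).card = N ↔ ∀ j : Fin n, p j.rev ↔ (j : ℕ) < N := by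
  rw [← card_filter_eq_iff hN (fun j : Fin n => p j.rev)
    (fun i j hij => hp _ _ (Fin.rev_le_rev.mpr hij))]
  have : (Finset.univ.filter fun j : Fin n => p j.rev).map Fin.revPerm.toEmbedding =
      Finset.univ.filter p := by
    ext j
    simp only [Finset.mem_map_equiv, Finset.mem_filter, Finset.mem_univ, true_and]
    simp
  rw [← this, Finset.card_map]

/-- Reversing both indices makes everything monotone increasing. The old first row becomes the final
row of the chain, equal to `c + 2` exactly from position `s` on, which is what the two-valued upper
bound encodes. -/
theorem card_planePartition_eq_sum_chainCount (a b c r s t : ℕ) (hr : r ≤ a + 2)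
    (hs : s ≤ b + 2) :
    (Nat.card {P : PlanePartition (a + 2) (b + 2) (c + 2) //
        (Finset.univ.filter fun j : Fin (b + 2) => P.entry 0 j = c + 2).card = b + 2 - s ∧
        (Finset.univ.filter fun i : Fin (a + 2) => P.entry i (Fin.last (b + 1)) = 0).card = r ∧
        P.entry (Fin.last (a + 1)) 0 = c + 2 - t} : ℚ) =
      ∑ μ ∈ boundedTuples (b + 2) 0 s (fun p => if (p : ℕ) < s then c + 1 else c + 2),
        chainCount b r (c + 2 - t) (a + 1) μ := by
  set U := boundedTuples (b + 2) 0 s (fun p => if (p : ℕ) < s then c + 1 else c + 2) with hU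
  have hmemU : ∀ μ : Fin (b + 2) → ℕ, μ ∈ U ↔ Monotone μ ∧ (∀ p, μ p ≤ c + 2) ∧
      ∀ p, μ p = c + 2 ↔ s ≤ (p : ℕ) := by
    intro μ
    rw [hU, mem_boundedTuples, and_comm, ← forall_and]
    refine and_congr_right fun _ => forall_congr' fun p => ?_
    by_cases hp : (p : ℕ) < s
    · have := not_le.mpr hp
      simp only [hp, this, if_true, forall_const, false_imp_iff, and_true, iff_false]
      omega
    · have := not_lt.mp hp
      simp only [hp, this, if_false, forall_const, false_imp_iff, true_and, iff_true]
      omega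
  have key := (card_subtype_eq_sum
    (fun q : Fin (a + 2) → Fin (b + 2) → ℕ => IsRowChain b r (c + 2 - t) (a + 1) q ∧
      q (Fin.last (a + 1)) ∈ U)
    (fun q => q (Fin.last (a + 1))) U (chainCount b r (c + 2 - t) (a + 1)) (fun q hq => hq.2)
    (fun μ hμ => by
      have e : {q : Fin (a + 2) → Fin (b + 2) → ℕ // (IsRowChain b r (c + 2 - t) (a + 1) q ∧
            q (Fin.last (a + 1)) ∈ U) ∧ q (Fin.last (a + 1)) = μ} ≃
          {q // IsRowChain b r (c + 2 - t) (a + 1) q ∧ q (Fin.last (a + 1)) = μ} :=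
        Equiv.subtypeEquivRight fun q =>
          ⟨fun h => ⟨h.1.1, h.2⟩, fun h => ⟨⟨h.1, h.2.symm ▸ hμ⟩, h.2⟩⟩
      obtain ⟨h1, h2⟩ := card_isRowChain b r (c + 2 - t) (a + 1) μ ((hmemU μ).mp hμ).1
      exact ⟨Finite.of_equiv _ e.symm, by rw [Nat.card_congr e, h2]⟩)).2
  rw [← key]
  congr 1
  have hle : ∀ q : Fin (a + 2) → Fin (b + 2) → ℕ, Monotone q → q (Fin.last (a + 1)) ∈ U →
      ∀ i j, q i j ≤ c + 2 := fun q hq hU' i j =>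
    (hq (Fin.le_last i) j).trans (((hmemU _).mp hU').2.1 j)
  have hiff : ∀ P : PlanePartition (a + 2) (b + 2) (c + 2),
      ((Finset.univ.filter fun j : Fin (b + 2) => P.entry 0 j = c + 2).card = b + 2 - s ∧
        (Finset.univ.filter fun i : Fin (a + 2) => P.entry i (Fin.last (b + 1)) = 0).card = r ∧
        P.entry (Fin.last (a + 1)) 0 = c + 2 - t) ↔
      (IsRowChain b r (c + 2 - t) (a + 1) (fun i j => P.entry i.rev j.rev) ∧
        (fun j : Fin (b + 2) => P.entry (Fin.last (a + 1)).rev j.rev) ∈ U) := by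
    intro P
    have hcol : Monotone fun (i : Fin (a + 2)) (j : Fin (b + 2)) => P.entry i.rev j.rev :=
      fun i i' h j => P.col_antitone _ (Fin.rev_le_rev.mpr h)
    have hrow : ∀ i, Monotone fun j : Fin (b + 2) => P.entry i j.rev :=
      fun i j j' h => P.row_antitone _ (Fin.rev_le_rev.mpr h)
    rw [card_filter_eq_iff (by omega) _ (fun i j hij (h : P.entry 0 j = c + 2) =>
        le_antisymm (P.entry_le _ _) (h.ge.trans (P.row_antitone 0 hij))),
      card_filter_eq_iff_of_upward hr _ (fun i j hij (h : P.entry i (Fin.last (b + 1)) = 0) =>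
        Nat.le_zero.mp ((P.col_antitone (Fin.last (b + 1)) hij).trans h.le)), hmemU, Fin.rev_last]
    have hrev : (∀ p : Fin (b + 2), P.entry 0 p.rev = c + 2 ↔ s ≤ (p : ℕ)) ↔
        ∀ j : Fin (b + 2), P.entry 0 j = c + 2 ↔ (j : ℕ) < b + 2 - s := by
      rw [← Fin.revPerm.forall_congr_right
        (q := fun j : Fin (b + 2) => P.entry 0 j = c + 2 ↔ (j : ℕ) < b + 2 - s)]
      refine forall_congr' fun p => ?_
      rw [Fin.revPerm_apply, Fin.val_rev]
      have := p.2
      refine iff_congr Iff.rfl ?_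
      omega
    rw [hrev]
    constructor
    · rintro ⟨h1, h2, h3⟩
      exact ⟨⟨hcol, fun i => hrow _, by simpa using h2, by simpa using h3⟩, hrow 0,
        fun p => P.entry_le _ _, h1⟩
    · rintro ⟨⟨-, -, h2, h3⟩, -, -, h1⟩
      exact ⟨h1, by simpa using h2, by simpa using h3⟩
  refine Nat.card_congr
    { toFun := fun x => ⟨fun i j => x.1.entry i.rev j.rev, (hiff x.1).mp x.2⟩
      invFun := fun y => ⟨⟨fun i j => y.1 i.rev j.rev, fun i j => hle _ y.2.1.col y.2.2 _ _,
        fun i j j' h => y.2.1.row _ (Fin.rev_le_rev.mpr h),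
        fun j i i' h => y.2.1.col (Fin.rev_le_rev.mpr h) _⟩, by
          rw [hiff]
          simpa using y.2⟩
      left_inv := fun x => by
        apply Subtype.ext
        ext i j
        simp
      right_inv := fun y => by
        apply Subtype.ext
        funext i j
        simp }

/-! ### Path numbers and Pascal's rule. -/

/-- The binomial coefficient `n.choose (k - j)` with the integer difference `k - j`. -/
def shiftedChoose (n k j : ℕ) : ℚ :=
  if j ≤ k then (n.choose (k - j) : ℚ) else 0

theorem shiftedChoose_succ_succ (n k j : ℕ) :
    shiftedChoose (n + 1) (k + 1) j = shiftedChoose n (k + 1) j + shiftedChoose n k j := by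
  unfold shiftedChoose
  rcases lt_trichotomy j (k + 1) with h | h | h
  · have h1 : j ≤ k := by omega
    rw [if_pos h1, if_pos h.le, if_pos h.le, Nat.succ_sub h1, Nat.choose_succ_succ]
    push_cast
    ring
  · subst h
    simp
  · rw [if_neg (by omega), if_neg (by omega), if_neg (by omega), add_zero]

theorem shiftedChoose_eq_zero_of_lt {n k j : ℕ} (h : k < j) : shiftedChoose n k j = 0 :=
  if_neg (by omega)

theorem shiftedChoose_self (n k : ℕ) : shiftedChoose n k k = 1 := by
  simp [shiftedChoose]

theorem shiftedChoose_eq_zero_of_add_lt {n k j : ℕ} (h : n + j < k) : shiftedChoose n k j = 0 := by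
  rw [shiftedChoose, if_pos (by omega), Nat.choose_eq_zero_of_lt (by omega), Nat.cast_zero]

/-- The number of lattice paths issuing from the marked corner entry `T`. -/
def cornerPaths (T I M : ℕ) : ℚ :=
  if T < M then shiftedChoose (M - T - 1) I 2 else if M = T ∧ I = 1 then 1 else 0

/-- The isolated value `1` at `M = T`, `I = 1` is the seed from which Pascal's rule generates the
binomials for `M > T`. The rule fails at `I = 0`, just before the seed. -/
theorem cornerPaths_succ_succ {T I M : ℕ} (hI : 1 ≤ I) :
    cornerPaths T (I + 1) (M + 1) = cornerPaths T (I + 1) M + cornerPaths T I M := by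
  unfold cornerPaths
  rcases lt_trichotomy T M with h | h | h
  · rw [if_pos (by omega), if_pos h, if_pos h, show M + 1 - T - 1 = M - T - 1 + 1 by omega,
      shiftedChoose_succ_succ]
  · subst h
    rw [if_pos (by omega), if_neg (by omega), if_neg (by omega), if_neg (by omega)]
    by_cases h1 : I = 1
    · subst h1
      simp [shiftedChoose_self]
    · rw [if_neg (by omega), shiftedChoose_eq_zero_of_add_lt (by omega), add_zero]
  · split_ifs <;> first | omega | simp

theorem cornerPaths_eq_zero {T I M : ℕ} (h : M + 1 < I) : cornerPaths T I M = 0 := by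
  unfold cornerPaths
  split_ifs with h1 h2
  · exact shiftedChoose_eq_zero_of_add_lt (by omega)
  · omega
  · rfl

/-- The numbers of lattice paths from the `b + 2` starting points to the point `(I, M)`. -/
def pathVector (b r T I M : ℕ) : Fin (b + 2) → ℚ := fun q =>
  if (q : ℕ) = 0 then shiftedChoose (M - r - 1) I (b + 2 + r)
  else if (q : ℕ) = b + 1 then cornerPaths T I M
  else shiftedChoose M I (b + 2 - q)

/-- The alternative in `h` concerns column `0` only: either the subtraction `M - r - 1` is not
truncated, or `I` is so small that the entries involved are `0` or `1` independently of `M`. -/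
theorem pathVector_succ_succ {b r T I M : ℕ} (hI : 1 ≤ I) (h : r + 1 ≤ M ∨ I + 1 ≤ b + 2 + r) :
    pathVector b r T (I + 1) (M + 1) = pathVector b r T (I + 1) M + pathVector b r T I M := by
  funext q
  simp only [pathVector, Pi.add_apply]
  split_ifs with h0 h1
  · by_cases hM : r + 1 ≤ M
    · rw [show M + 1 - r - 1 = M - r - 1 + 1 by omega, shiftedChoose_succ_succ]
    · have hI1 : I + 1 ≤ b + 2 + r := h.resolve_left hM
      rw [shiftedChoose_eq_zero_of_lt (show I < b + 2 + r by omega), add_zero]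
      rcases hI1.lt_or_eq with h2 | h2
      · rw [shiftedChoose_eq_zero_of_lt h2, shiftedChoose_eq_zero_of_lt h2]
      · rw [h2, shiftedChoose_self, shiftedChoose_self]
  · exact cornerPaths_succ_succ hI
  · exact shiftedChoose_succ_succ _ _ _

/-- Makes the one surviving lower limit, at the first summed position, vanish while the leading
entry is forced to be `0`; `pathVector_eq_zero_of_le` does the same for lower bound `1`. -/
theorem pathVector_eq_zero_of_lt {b r T k : ℕ} (hk : k < r) :
    pathVector b r T (b + 2 + k) k = 0 := by
  funext q
  simp only [pathVector, Pi.zero_apply]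
  split_ifs with h0 h1
  · exact shiftedChoose_eq_zero_of_lt (by omega)
  · exact cornerPaths_eq_zero (by omega)
  · exact shiftedChoose_eq_zero_of_add_lt (by omega)

theorem pathVector_eq_zero_of_le {b r T k : ℕ} (hk : r ≤ k) :
    pathVector b r T (b + 3 + k) (k + 1) = 0 := by
  funext q
  simp only [pathVector, Pi.zero_apply]
  split_ifs with h0 h1
  · exact shiftedChoose_eq_zero_of_add_lt (by omega)
  · exact cornerPaths_eq_zero (by omega)
  · exact shiftedChoose_eq_zero_of_add_lt (by omega)

theorem pathVector_apply_zero_of_lt {b r T I M : ℕ} (h : I < b + 2 + r) :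
    pathVector b r T I M 0 = 0 := by
  simp [pathVector, shiftedChoose_eq_zero_of_lt h]

theorem pathVector_apply_zero_self (b r T M : ℕ) :
    pathVector b r T (b + 2 + r) M 0 = 1 := by
  simp [pathVector, shiftedChoose_self]

/-! ### The chain count as a determinant. -/

theorem det_cons_eq_det_submatrix {n : ℕ} (v : Fin (n + 1) → ℚ) (R : Fin n → Fin (n + 1) → ℚ)
    (hv : v 0 = 1) (hR : ∀ p, R p 0 = 0) :
    Matrix.det (Fin.cons v R : Fin (n + 1) → Fin (n + 1) → ℚ) =
      Matrix.det (fun p q => R p (Fin.succ q)) := by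
  change Matrix.det (Matrix.of (Fin.cons v R : Fin (n + 1) → Fin (n + 1) → ℚ)) = _
  rw [Matrix.det_succ_column_zero, Fin.sum_univ_succ]
  simp only [Matrix.of_apply, Fin.cons_zero, Fin.cons_succ, hv, hR, mul_zero, zero_mul, Finset.sum_const_zero,
    add_zero, Fin.val_zero, pow_zero, one_mul]
  congr 1

/-- When the lower rows vanish in column `0`, only the leading entry of the top row matters. This
allows the unit row used for forced zeros to be exchanged for a genuine path row. -/
theorem det_cons_congr {n : ℕ} {v w : Fin (n + 1) → ℚ} {R : Fin n → Fin (n + 1) → ℚ}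
    (hv : v 0 = 1) (hw : w 0 = 1) (hR : ∀ p, R p 0 = 0) :
    Matrix.det (Fin.cons v R : Fin (n + 1) → Fin (n + 1) → ℚ) =
      Matrix.det (Fin.cons w R : Fin (n + 1) → Fin (n + 1) → ℚ) := by
  rw [det_cons_eq_det_submatrix v R hv hR, det_cons_eq_det_submatrix w R hw hR]

theorem sum_boundedTuples_zero_eq {n s : ℕ} {u : Fin (n + 1) → ℕ}
    (f : (Fin (n + 1) → ℕ) → ℚ) (hf : ∀ μ, μ 0 = 0 → f μ = 0) :
    ∑ μ ∈ boundedTuples (n + 1) 0 s u, f μ = ∑ μ ∈ boundedTuples (n + 1) 1 s u, f μ := by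
  symm
  refine Finset.sum_subset (fun μ hμ => ?_) (fun μ hμ hμ' => hf μ ?_)
  · rw [mem_boundedTuples] at hμ ⊢
    exact ⟨fun p => ⟨fun hp => ⟨Nat.zero_le _, ((hμ.1 p).1 hp).2⟩, (hμ.1 p).2⟩, hμ.2⟩
  · by_contra h0
    apply hμ'
    rw [mem_boundedTuples] at hμ ⊢
    refine ⟨fun p => ⟨fun hp => ⟨?_, ((hμ.1 p).1 hp).2⟩, (hμ.1 p).2⟩, hμ.2⟩
    exact (Nat.one_le_iff_ne_zero.mpr h0).trans (hμ.2 (Fin.zero_le p))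

/-- Row `p` of the path matrix for a chain of `k + 1` rows whose entry in position `p` is `m`. -/
def pathRow (b r T k p m : ℕ) : Fin (b + 2) → ℚ :=
  if p = 0 ∧ k < r then Pi.single 0 1 else pathVector b r T (b + 2 - p + k) (m + k)

theorem sum_pathRow_of_lt {b r T k s : ℕ} (hk : k < r) {u : Fin (b + 2) → ℕ} (hu : Monotone u)
    (f : (Fin (b + 2) → ℕ) → ℚ)
    (hf : ∀ μ, Monotone μ →
      f μ = if (μ 0 = 0 ↔ k < r) then Matrix.det (fun p => pathRow b r T k p (μ p)) else 0) :
    ∑ μ ∈ boundedTuples (b + 2) 0 (s + 1) u, f μ =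
      Matrix.det (Fin.cons (Pi.single 0 1 : Fin (b + 2) → ℚ) (fun p : Fin (b + 1) =>
        if (p : ℕ) < s then pathVector b r T (b + 2 - p + k) (u p.succ + 1 + k)
        else pathVector b r T (b + 1 - p + k) (u p.succ + k)) :
          Fin (b + 2) → Fin (b + 2) → ℚ) := by
  -- For `k < r` the leading entry must be `0`, so the first position is not summed and its unit row
  -- stays in place.
  rw [sum_boundedTuples_succ hu, Finset.sum_eq_single 0]
  · have hrow : ∀ μ ∈ boundedTuples (b + 1) 0 s (Fin.tail u),
        f (Fin.cons 0 μ) =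
          (Matrix.detRowAlternating.curryLeft (Pi.single 0 1 : Fin (b + 2) → ℚ))
            (fun p => pathVector b r T (b + 1 - p + k) (μ p + k)) := by
      intro μ hμ
      rw [hf _ (Fin.monotone_cons_iff.mpr ⟨fun _ => Nat.zero_le _, (mem_boundedTuples.mp hμ).2⟩),
        if_pos (by simp [hk]), AlternatingMap.curryLeft_apply_apply]
      change Matrix.det _ = Matrix.det _
      congr 1
      funext p
      induction p using Fin.cases with
      | zero => simp [pathRow, hk]
      | succ p =>
        simp [pathRow]
    rw [Finset.sum_congr rfl hrow,
      sum_alternating_boundedTuples (b + 1) s 0 _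
        (fun p m => pathVector b r T (b + 1 - p + k) (m + k))
        (fun p m => pathVector b r T (b + 2 - p + k) (m + k)) (Fin.tail u)
        (fun i j hij => hu (Fin.succ_le_succ_iff.mpr hij)) (fun _ => Nat.zero_le _)
        (fun p m hp _ => ?_) (fun p m hp => by
          rw [show b + 2 - (p + 1) = b + 1 - p by omega]),
      AlternatingMap.curryLeft_apply_apply]
    · change Matrix.det (Fin.cons _ _ : Fin (b + 2) → Fin (b + 2) → ℚ) = _
      congr 2
      funext p
      have h0 : pathVector b r T (b + 2 + k) k = 0 := pathVector_eq_zero_of_lt hk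
      by_cases hp : (p : ℕ) = 0
      · simp [hp, h0, Fin.tail]
      · simp [hp, Fin.tail]
    · rw [show m + 1 + k = m + k + 1 by omega, show b + 2 - p + k = b + 1 - p + k + 1 by omega]
      exact pathVector_succ_succ (by omega) (Or.inr (by omega))
  · intro m _ hm
    refine Finset.sum_eq_zero fun μ hμ => ?_
    have hmono : Monotone (Fin.cons m μ : Fin (b + 2) → ℕ) := by
      rename_i h
      exact (mem_boundedTuples.mp ((cons_mem_boundedTuples hu).mpr ⟨h, hμ⟩)).2
    rw [hf _ hmono, if_neg (by simp [hm, hk])]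
  · intro h
    simp at h

theorem sum_pathRow_of_le {b r T k s : ℕ} (hk : r ≤ k) {u : Fin (b + 2) → ℕ} (hu : Monotone u)
    (hu1 : ∀ p, 1 ≤ u p) (f : (Fin (b + 2) → ℕ) → ℚ)
    (hf : ∀ μ, Monotone μ →
      f μ = if (μ 0 = 0 ↔ k < r) then Matrix.det (fun p => pathRow b r T k p (μ p)) else 0) :
    ∑ μ ∈ boundedTuples (b + 2) 0 s u, f μ =
      Matrix.det (fun p : Fin (b + 2) =>
        if (p : ℕ) < s then pathVector b r T (b + 3 - p + k) (u p + 1 + k)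
        else pathVector b r T (b + 2 - p + k) (u p + k)) := by
  have hrow : ∀ μ ∈ boundedTuples (b + 2) 1 s u,
      f μ = Matrix.detRowAlternating fun p : Fin (b + 2) =>
        pathVector b r T (b + 2 - p + k) (μ p + k) := by
    intro μ hμ
    rw [mem_boundedTuples] at hμ
    have h0 : 1 ≤ μ 0 := by
      by_cases hs : ((0 : Fin (b + 2)) : ℕ) < s
      · exact ((hμ.1 0).1 hs).1
      · rw [(hμ.1 0).2 (not_lt.mp hs)]
        exact hu1 0
    rw [hf _ hμ.2, if_pos (by omega)]
    change Matrix.det _ = Matrix.det _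
    congr 1
    funext p
    rw [pathRow, if_neg (by omega)]
  have hzero : ∑ μ ∈ boundedTuples (b + 2) 0 s u, f μ =
      ∑ μ ∈ boundedTuples (b + 2) 1 s u, f μ := by
    -- The formula for `f` is known only on monotone tuples, so `f` is cut off to zero elsewhere.
    have := sum_boundedTuples_zero_eq (s := s) (u := u) (fun μ => if Monotone μ then f μ else 0)
      (fun μ h0 => by
        split_ifs with hm
        · rw [hf μ hm, if_neg (by omega)]
        · rfl)
    have hcongr : ∀ L, ∑ μ ∈ boundedTuples (b + 2) L s u, f μ =
        ∑ μ ∈ boundedTuples (b + 2) L s u, if Monotone μ then f μ else 0 := fun L =>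
      Finset.sum_congr rfl fun μ hμ => by rw [if_pos (mem_boundedTuples.mp hμ).2]
    rw [hcongr, hcongr, this]
  rw [hzero, Finset.sum_congr rfl hrow,
    sum_alternating_boundedTuples (b + 2) s 1 _
      (fun p m => pathVector b r T (b + 2 - p + k) (m + k))
      (fun p m => pathVector b r T (b + 3 - p + k) (m + k)) u hu hu1
      (fun p m hp hm => ?_) (fun p m hp => by
        rw [show b + 3 - (p + 1) = b + 2 - p by omega])]
  · change Matrix.det _ = _
    congr 1
    funext p
    have h0 : pathVector b r T (b + 3 + k) (1 + k) = 0 := by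
      rw [add_comm 1 k]
      exact pathVector_eq_zero_of_le hk
    by_cases hp : (p : ℕ) = 0
    · simp [hp, h0]
    · simp [hp]
  · rw [show m + 1 + k = m + k + 1 by omega, show b + 3 - p + k = b + 2 - p + k + 1 by omega]
    exact pathVector_succ_succ (by omega) (Or.inl (by omega))

/-- For a single row the matrix is upper triangular. Its diagonal entries are `1` except the last,
which tests the corner value. -/
theorem det_pathRow_zero (b r T : ℕ) (u : Fin (b + 2) → ℕ) (hu : u 0 = 0 ↔ 0 < r) :
    Matrix.det (fun p : Fin (b + 2) => pathRow b r T 0 p (u p)) =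
      if u (Fin.last (b + 1)) = T then 1 else 0 := by
  have hupper : Matrix.IsUpperTriangular
      (Matrix.of fun p : Fin (b + 2) => pathRow b r T 0 p (u p)) := by
    intro p q hpq
    have hpq' : (q : ℕ) < p := hpq
    simp only [Matrix.of_apply]
    rw [pathRow, if_neg (by omega), pathVector]
    have := p.2
    split_ifs with h0 h1
    · exact shiftedChoose_eq_zero_of_lt (by omega)
    · omega
    · exact shiftedChoose_eq_zero_of_lt (by omega)
  change Matrix.det (Matrix.of fun p : Fin (b + 2) => pathRow b r T 0 p (u p)) = _
  rw [Matrix.det_of_isUpperTriangular hupper, Fin.prod_univ_castSucc]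
  have hlast : (Matrix.of fun p : Fin (b + 2) => pathRow b r T 0 p (u p)) (Fin.last (b + 1))
      (Fin.last (b + 1)) = if u (Fin.last (b + 1)) = T then 1 else 0 := by
    simp only [Matrix.of_apply, pathRow, Fin.val_last]
    rw [if_neg (by omega), pathVector]
    simp only [Fin.val_last]
    rw [if_neg (by omega), if_true, cornerPaths]
    by_cases h1 : T < u (Fin.last (b + 1))
    · rw [if_pos (by omega), if_neg (by omega), shiftedChoose_eq_zero_of_lt (by omega)]
    · rw [if_neg (by omega)]
      refine if_congr ?_ rfl rfl
      omega
  rw [hlast, Finset.prod_eq_one, one_mul]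
  intro p _
  simp only [Matrix.of_apply, pathRow]
  have := p.2
  by_cases hp : (p : ℕ) = 0
  · have hp0 : p = 0 := Fin.ext hp
    subst hp0
    by_cases hr : 0 < r
    · simp [hr]
    · obtain rfl : r = 0 := by omega
      simp [pathVector, shiftedChoose_self]
  · rw [if_neg (by simp [hp]), pathVector]
    simp only [Fin.val_castSucc]
    simp only [if_neg hp, if_neg (show (p : ℕ) ≠ b + 1 by omega), Nat.add_zero, shiftedChoose_self]

theorem chainCount_eq_det (b r T : ℕ) : ∀ (k : ℕ) (u : Fin (b + 2) → ℕ), Monotone u →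
    chainCount b r T k u =
      if (u 0 = 0 ↔ k < r) then Matrix.det (fun p => pathRow b r T k p (u p)) else 0 := by
  intro k
  induction k with
  | zero =>
    intro u _
    rw [chainCount]
    by_cases h : u 0 = 0 ↔ 0 < r
    · rw [if_pos h, det_pathRow_zero b r T u h]
      exact if_congr (and_iff_left h) rfl rfl
    · rw [if_neg h, if_neg (fun h' => h h'.2)]
  | succ k ih =>
    intro u hu
    rw [chainCount]
    refine if_ctx_congr Iff.rfl (fun h => ?_) (fun _ => rfl)
    by_cases hk : k < r
    · rw [sum_pathRow_of_lt (s := b + 1) hk hu _ ih]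
      have hR : (fun p : Fin (b + 1) =>
          if (p : ℕ) < b + 1 then pathVector b r T (b + 2 - p + k) (u p.succ + 1 + k)
          else pathVector b r T (b + 1 - p + k) (u p.succ + k)) =
          fun p : Fin (b + 1) => pathRow b r T (k + 1) (p.succ : Fin (b + 2)) (u p.succ) := by
        funext p
        have := p.2
        rw [if_pos this, pathRow, Fin.val_succ, if_neg (by omega)]
        congr 1 <;> omega
      have hcons : (fun p : Fin (b + 2) => pathRow b r T (k + 1) p (u p)) =
          Fin.cons (pathRow b r T (k + 1) 0 (u 0))
            (fun p : Fin (b + 1) => pathRow b r T (k + 1) (p.succ : Fin (b + 2)) (u p.succ)) := by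
        funext p
        induction p using Fin.cases with
        | zero => rfl
        | succ p => rfl
      rw [hR, hcons]
      by_cases hk1 : k + 1 < r
      · rw [show pathRow b r T (k + 1) 0 (u 0) = Pi.single 0 1 by simp [pathRow, hk1]]
      -- The transition: the next leading entry is no longer forced to vanish, and the unit row is
      -- traded for the path row, whose column `0` entry is also `1`.
      · obtain rfl : k + 1 = r := by omega
        refine det_cons_congr (by simp) ?_ (fun p => ?_)
        · rw [pathRow, if_neg (by omega)]
          exact pathVector_apply_zero_self _ _ _ _
        · rw [pathRow, if_neg (by simp)]
          have := p.2
          exact pathVector_apply_zero_of_lt (by rw [Fin.val_succ]; omega)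
    · have hk' : r ≤ k := not_lt.mp hk
      have h0 : 1 ≤ u 0 := by omega
      rw [sum_pathRow_of_le hk' hu (fun p => h0.trans (hu (Fin.zero_le p))) _ ih]
      congr 1
      funext p
      have := p.2
      rw [if_pos this, pathRow, if_neg (by omega)]
      congr 1 <;> omega

/-- The boundary-refined count of plane partitions as a determinant of path numbers. -/
theorem card_planePartition_eq_det (a b c r s t : ℕ) (hr : r ≤ a + 2) (hs : s < b + 3) :
    (Nat.card {P : PlanePartition (a + 2) (b + 2) (c + 2) //
        (Finset.univ.filter fun j : Fin (b + 2) => P.entry 0 j = c + 2).card = b + 2 - s ∧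
        (Finset.univ.filter fun i : Fin (a + 2) => P.entry i (Fin.last (b + 1)) = 0).card = r ∧
        P.entry (Fin.last (a + 1)) 0 = c + 2 - t} : ℚ) =
      Matrix.det (fun p : Fin (b + 2) => pathVector b r (c + 2 - t)
        (a + b + 4 - ((⟨s, hs⟩ : Fin (b + 3)).succAbove p : ℕ)) (a + c + 3)) := by
  rw [card_planePartition_eq_sum_chainCount a b c r s t hr (by omega)]
  set T := c + 2 - t
  set u : Fin (b + 2) → ℕ := fun p => if (p : ℕ) < s then c + 1 else c + 2 with hu
  have humono : Monotone u := by
    intro i j hij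
    have : (i : ℕ) ≤ j := hij
    simp only [hu]
    split_ifs <;> omega
  have hval : ∀ p : Fin (b + 2), ((⟨s, hs⟩ : Fin (b + 3)).succAbove p : ℕ) =
      if (p : ℕ) < s then (p : ℕ) else p + 1 := by
    intro p
    by_cases hp : (p : ℕ) < s
    · rw [if_pos hp, Fin.succAbove_of_castSucc_lt _ _ (by simpa [Fin.lt_def] using hp)]
      rfl
    · rw [if_neg hp, Fin.succAbove_of_le_castSucc _ _ (by simpa [Fin.le_def] using hp)]
      rfl
  by_cases hra : a + 1 < r
  · obtain rfl : r = a + 2 := by omega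
    cases s with
    -- The last column is entirely zero while the first row is entirely `c + 2`. No partition
    -- exists, and column `0` of the determinant vanishes.
    | zero =>
      rw [boundedTuples_eq_singleton humono (Or.inr rfl), Finset.sum_singleton,
        chainCount_eq_det b _ T _ u humono, if_neg (by simp [hu])]
      symm
      refine Matrix.det_eq_zero_of_column_eq_zero 0 fun p => ?_
      exact pathVector_apply_zero_of_lt (by rw [hval, if_neg (by omega)]; omega)
    | succ s =>
      rw [sum_pathRow_of_lt (s := s) hra humono _ (chainCount_eq_det b _ T _)]
      have hcons : (fun p : Fin (b + 2) => pathVector b (a + 2) T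
          (a + b + 4 - ((⟨s + 1, hs⟩ : Fin (b + 3)).succAbove p : ℕ)) (a + c + 3)) =
          Fin.cons (pathVector b (a + 2) T (b + 2 + (a + 2)) (a + c + 3))
            (fun p : Fin (b + 1) =>
              if (p : ℕ) < s then pathVector b (a + 2) T (b + 2 - p + (a + 1))
                (u p.succ + 1 + (a + 1))
              else pathVector b (a + 2) T (b + 1 - p + (a + 1)) (u p.succ + (a + 1))) := by
        funext p
        rw [hval]
        induction p using Fin.cases with
        | zero =>
          rw [Fin.cons_zero, Fin.val_zero, if_pos (by omega)]
          congr 1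
          omega
        | succ p =>
          have := p.2
          simp only [Fin.cons_succ, Fin.val_succ, hu]
          split_ifs with h1 h2 <;> first | omega | (congr 1 <;> omega)
      rw [hcons]
      refine det_cons_congr (by simp) (pathVector_apply_zero_self _ _ _ _) (fun p => ?_)
      split_ifs
      · exact pathVector_apply_zero_of_lt (by omega)
      · exact pathVector_apply_zero_of_lt (by omega)
  · rw [sum_pathRow_of_le (by omega) humono (fun p => by simp only [hu]; split_ifs <;> omega) _
      (chainCount_eq_det b _ T _)]
    -- A summed position has bound `c + 1` and gains one in both coordinates; a frozen one has value
    -- `c + 2` and gains none. So all rows share `M = a + c + 3`, and the values `I = a + b + 4 - y`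
    -- skip exactly `y = s`.
    congr 1
    funext p
    have := p.2
    rw [hval]
    simp only [hu]
    split_ifs
    · congr 1 <;> omega
    · congr 1 <;> omega

/-! ### Rising factorials and alternating binomial sums. -/

theorem risingFactorial_natCast_add_one (n k : ℕ) :
    risingFactorial ((n : ℚ) + 1) k = ((n + k).factorial : ℚ) / n.factorial := by
  rw [risingFactorial, show (n : ℚ) + 1 = ((n + 1 : ℕ) : ℚ) by push_cast; rfl,
    ← ascPochhammer_eval_cast, ascPochhammer_nat_eq_ascFactorial, eq_div_iff (by positivity),
    mul_comm, ← Nat.cast_mul, Nat.factorial_mul_ascFactorial]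

theorem risingFactorial_neg_eq_zero {j k : ℕ} (h : j < k) :
    risingFactorial (-(j : ℚ)) k = 0 :=
  (ascPochhammer_eval_eq_zero_iff _ _).mpr ⟨j, h, by simp⟩

theorem risingFactorial_succ_right (x : ℚ) (k : ℕ) :
    risingFactorial x (k + 1) = risingFactorial x k * (x + k) := by
  rw [risingFactorial, risingFactorial, ascPochhammer_succ_eval]

theorem sum_range_choose_succ_mul_sub (ρ : ℕ) (f : ℕ → ℚ) :
    ∑ y ∈ Finset.range (ρ + 2), (-1) ^ y * ((ρ + 1).choose y : ℚ) * f y =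
      ∑ y ∈ Finset.range (ρ + 1), (-1) ^ y * (ρ.choose y : ℚ) * (f y - f (y + 1)) := by
  have h := Finset.sum_choose_succ_mul (fun i _ => (-1) ^ i * f i) ρ
  have h1 : ∑ y ∈ Finset.range (ρ + 2), (-1) ^ y * ((ρ + 1).choose y : ℚ) * f y =
      ∑ y ∈ Finset.range (ρ + 2), ((ρ + 1).choose y : ℚ) * ((-1) ^ y * f y) :=
    Finset.sum_congr rfl fun _ _ => by ring
  rw [h1, h, add_comm, ← Finset.sum_add_distrib]
  exact Finset.sum_congr rfl fun _ _ => by ring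

/-- The left side is an iterated difference, and by Pascal's rule each difference lowers `n` by one.
Lower index `K` on the right gives the correct value zero when `ρ > n`. -/
theorem sum_range_choose_mul_choose_sub (ρ : ℕ) : ∀ n K : ℕ, ρ ≤ n + K →
    ∑ y ∈ Finset.range (ρ + 1), (-1) ^ y * (ρ.choose y : ℚ) * ((n + K - y).choose n : ℚ) =
      ((n + K - ρ).choose K : ℚ) := by
  induction ρ with
  | zero =>
    intro n K _
    simp only [zero_add, Finset.range_one, Finset.sum_singleton, pow_zero, Nat.choose_self,
      Nat.cast_one, one_mul, Nat.sub_zero]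
    rw [Nat.choose_symm_add]
  | succ ρ ih =>
    intro n K h
    rw [sum_range_choose_succ_mul_sub ρ (fun y => ((n + K - y).choose n : ℚ))]
    cases n with
    | zero =>
      rw [Nat.choose_eq_zero_of_lt (show 0 + K - (ρ + 1) < K by omega)]
      simp
    | succ n =>
      rw [show n + 1 + K - (ρ + 1) = n + K - ρ by omega, ← ih n K (by omega)]
      refine Finset.sum_congr rfl fun y hy => ?_
      rw [Finset.mem_range] at hy
      rw [show n + 1 + K - y = n + K - y + 1 by omega,
        show n + 1 + K - (y + 1) = n + K - y by omega, Nat.choose_succ_succ]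
      push_cast
      ring

theorem choose_add_add_eq_div (m n k : ℕ) :
    ((m + n).choose (m + k) : ℚ) * ((m + k).factorial : ℚ) * n.factorial =
      (m + n).factorial * n.choose k * k.factorial := by
  by_cases h : k ≤ n
  · rw [Nat.cast_choose ℚ (show m + k ≤ m + n by omega), Nat.cast_choose ℚ h,
      show m + n - (m + k) = n - k by omega]
    field_simp
  · rw [Nat.choose_eq_zero_of_lt (by omega), Nat.choose_eq_zero_of_lt (by omega)]
    simp

/-- A Vandermonde-type evaluation of an alternating sum against a one-sided path column. -/
theorem sum_risingFactorial_mul_choose (b c e ρ : ℕ) (hρ : ρ ≤ e + b + 2) :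
    ∑ y ∈ Finset.range (b + 3), (-1) ^ y * risingFactorial ((y : ℚ) + 1) c *
        risingFactorial ((b : ℚ) + 3 - y) e * ((c + ρ).choose (c + y) : ℚ) =
      ((c + ρ).factorial : ℚ) / ρ.factorial * e.factorial * ((e + (b + 2) - ρ).choose (b + 2) : ℚ)
      := by
  have hterm : ∀ y ∈ Finset.range (b + 3), (-1) ^ y * risingFactorial ((y : ℚ) + 1) c *
        risingFactorial ((b : ℚ) + 3 - y) e * ((c + ρ).choose (c + y) : ℚ) =
      ((c + ρ).factorial : ℚ) / ρ.factorial * e.factorial *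
        ((-1) ^ y * (ρ.choose y : ℚ) * ((e + (b + 2) - y).choose e : ℚ)) := by
    intro y hy
    rw [Finset.mem_range] at hy
    have h1 : (b : ℚ) + 3 - y = ((b + 2 - y : ℕ) : ℚ) + 1 := by
      rw [Nat.cast_sub (by omega)]
      push_cast
      ring
    have h2 := choose_add_add_eq_div c ρ y
    rw [h1, risingFactorial_natCast_add_one, risingFactorial_natCast_add_one,
      show e + (b + 2) - y = b + 2 - y + e by omega,
      Nat.cast_choose ℚ (show e ≤ b + 2 - y + e by omega), Nat.add_sub_cancel, add_comm y c]
    field_simp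
    linear_combination h2
  rw [Finset.sum_congr rfl hterm, ← Finset.mul_sum]
  congr 1
  rw [← sum_range_choose_mul_choose_sub ρ e (b + 2) (by omega)]
  -- The two sums run over `y < b + 3` and `y < ρ + 1`. Both extend to a common range, since the
  -- additional terms vanish; the bound `hρ` is needed for this when `e = 0`.
  have hext : ∀ N M : ℕ, (∀ y, N ≤ y → y < N + M →
      ((ρ.choose y : ℚ)) * ((e + (b + 2) - y).choose e : ℚ) = 0) →
      ∑ y ∈ Finset.range (N + M),
          (-1) ^ y * (ρ.choose y : ℚ) * ((e + (b + 2) - y).choose e : ℚ) =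
        ∑ y ∈ Finset.range N,
          (-1) ^ y * (ρ.choose y : ℚ) * ((e + (b + 2) - y).choose e : ℚ) := by
    intro N M h
    rw [Finset.sum_range_add, add_eq_left]
    refine Finset.sum_eq_zero fun x hx => ?_
    rw [Finset.mem_range] at hx
    rw [mul_assoc, h _ (by omega) (by omega), mul_zero]
  rw [← hext (b + 3) (ρ + 1) (fun y hy hy' => ?_), add_comm (b + 3) (ρ + 1),
    hext (ρ + 1) (b + 3) (fun y hy hy' => ?_)]
  · rw [Nat.choose_eq_zero_of_lt (show ρ < y by omega), Nat.cast_zero, zero_mul]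
  · by_cases hyρ : ρ < y
    · rw [Nat.choose_eq_zero_of_lt hyρ, Nat.cast_zero, zero_mul]
    · by_cases he : e = 0
      · omega
      · rw [Nat.choose_eq_zero_of_lt (show e + (b + 2) - y < e by omega), Nat.cast_zero, mul_zero]

theorem sum_range_choose_mul_eval_eq_zero (P : Polynomial ℚ) {n : ℕ} (hP : P.natDegree < n)
    (x : ℚ) : ∑ k ∈ Finset.range (n + 1), (-1) ^ k * (n.choose k : ℚ) * P.eval (x + k) = 0 := by
  have h := congrFun (Polynomial.fwdDiff_iter_eq_zero_of_degree_lt hP) x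
  rw [fwdDiff_iter_eq_sum_shift] at h
  simp only [zsmul_eq_mul, nsmul_eq_mul, mul_one, Pi.zero_apply] at h
  have h2 : ∑ k ∈ Finset.range (n + 1), (-1) ^ k * (n.choose k : ℚ) * P.eval (x + k) =
      (-1) ^ n * ∑ k ∈ Finset.range (n + 1),
        (((-1) ^ (n - k) * (n.choose k : ℤ) : ℤ) : ℚ) * P.eval (x + k) := by
    rw [Finset.mul_sum]
    refine Finset.sum_congr rfl fun k hk => ?_
    rw [Finset.mem_range] at hk
    obtain ⟨j, rfl⟩ := Nat.exists_eq_add_of_le (Nat.lt_succ_iff.mp hk)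
    rw [Nat.add_sub_cancel_left]
    push_cast
    rw [pow_add]
    have : ((-1 : ℚ) ^ j) * (-1) ^ j = 1 := by rw [← mul_pow]; simp
    linear_combination (-(-1) ^ k * ((k + j).choose k : ℚ) * P.eval (x + k)) * this
  rw [h2, h, mul_zero]

theorem shiftedChoose_symm {n k j k' j' : ℕ} (h : k + k' = n + j + j') :
    shiftedChoose n k j = shiftedChoose n k' j' := by
  unfold shiftedChoose
  split_ifs with h1 h2 h2
  · rw [Nat.choose_symm_of_eq_add (show n = (k - j) + (k' - j') by omega)]
  · rw [Nat.choose_eq_zero_of_lt (by omega), Nat.cast_zero]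
  · rw [Nat.choose_eq_zero_of_lt (by omega), Nat.cast_zero]
  · rfl

/-- The two-sided path columns are annihilated by polynomial weights of small degree. -/
theorem sum_risingFactorial_mul_shiftedChoose (a b c d q : ℕ) (hd : d ≤ 2) (hq : 1 ≤ q)
    (hqb : q ≤ b) :
    ∑ y ∈ Finset.range (b + 3), (-1) ^ y * risingFactorial ((y : ℚ) + 1) (c + d) *
        risingFactorial ((b : ℚ) + 3 - y) a * shiftedChoose (a + c + 3) (c + 1 + y) q = 0 := by
  set P : Polynomial ℚ := ((ascPochhammer ℚ (c + d)).comp (Polynomial.X + Polynomial.C 1)) *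
    ((ascPochhammer ℚ a).comp (Polynomial.C ((b : ℚ) + 3) - Polynomial.X)) with hP
  have hPeval : ∀ x, P.eval x = risingFactorial (x + 1) (c + d) *
      risingFactorial ((b : ℚ) + 3 - x) a := by
    intro x
    simp [hP, risingFactorial]
  have hPdeg : P.natDegree < a + c + 3 := by
    refine (Polynomial.natDegree_mul_le.trans (add_le_add Polynomial.natDegree_comp_le
      Polynomial.natDegree_comp_le)).trans_lt ?_
    rw [ascPochhammer_natDegree, ascPochhammer_natDegree, Polynomial.natDegree_X_add_C]
    have : (Polynomial.C ((b : ℚ) + 3) - Polynomial.X).natDegree ≤ 1 := by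
      refine (Polynomial.natDegree_sub_le _ _).trans ?_
      simp
    nlinarith
  -- With `i = c + 1 + y`, the sum extends beyond `0 ≤ y ≤ b + 2` for free: the rising factorials
  -- vanish for `1 ≤ i ≤ c` and at the `a` indices above the range, and the binomial vanishes at `i
  -- = 0`.
  set f : ℕ → ℚ := fun i => (-1) ^ i * shiftedChoose (a + c + 3) i q *
    P.eval ((i : ℚ) - (c + 1)) with hf
  have hleft : ∑ i ∈ Finset.range (c + 1 + (b + 3) + a), f i = (-1) ^ (c + 1) *
      ∑ y ∈ Finset.range (b + 3), (-1) ^ y * risingFactorial ((y : ℚ) + 1) (c + d) *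
        risingFactorial ((b : ℚ) + 3 - y) a * shiftedChoose (a + c + 3) (c + 1 + y) q := by
    rw [Finset.sum_range_add, Finset.sum_range_add, Finset.mul_sum]
    have h1 : ∑ i ∈ Finset.range (c + 1), f i = 0 := by
      refine Finset.sum_eq_zero fun i hi => ?_
      rw [Finset.mem_range] at hi
      simp only [hf, hPeval]
      by_cases h0 : i = 0
      · rw [h0, shiftedChoose_eq_zero_of_lt (by omega)]
        simp
      · rw [show (i : ℚ) - (c + 1) + 1 = -((c - i : ℕ) : ℚ) by
            rw [Nat.cast_sub (by omega)]
            ring,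
          risingFactorial_neg_eq_zero (by omega)]
        simp
    have h2 : ∑ x ∈ Finset.range a, f (c + 1 + (b + 3) + x) = 0 := by
      refine Finset.sum_eq_zero fun i hi => ?_
      rw [Finset.mem_range] at hi
      simp only [hf, hPeval]
      rw [show (b : ℚ) + 3 - (((c + 1 + (b + 3) + i : ℕ) : ℚ) - (c + 1)) = -(i : ℚ) by
          push_cast
          ring,
        risingFactorial_neg_eq_zero hi]
      simp
    rw [h1, h2, zero_add, add_zero]
    refine Finset.sum_congr rfl fun y _ => ?_
    simp only [hf, hPeval]
    rw [show ((c + 1 + y : ℕ) : ℚ) - (c + 1) = y by push_cast; ring, pow_add]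
    ring
  -- The extended range contains the whole support `q ≤ i ≤ q + a + c + 3` of the binomial because
  -- `q ≤ b`, so the sum is a full difference of order `a + c + 3`.
  have hright : ∑ i ∈ Finset.range (q + (a + c + 3 + 1) + (b - q)), f i = 0 := by
    rw [Finset.sum_range_add, Finset.sum_range_add]
    have h1 : ∑ i ∈ Finset.range q, f i = 0 := by
      refine Finset.sum_eq_zero fun i hi => ?_
      rw [Finset.mem_range] at hi
      simp only [hf]
      rw [shiftedChoose_eq_zero_of_lt hi]
      simp
    have h2 : ∑ x ∈ Finset.range (b - q), f (q + (a + c + 3 + 1) + x) = 0 := by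
      refine Finset.sum_eq_zero fun i _ => ?_
      simp only [hf]
      rw [shiftedChoose_eq_zero_of_add_lt (by omega)]
      simp
    rw [h1, h2, zero_add, add_zero]
    have h3 := sum_range_choose_mul_eval_eq_zero P hPdeg ((q : ℚ) - (c + 1))
    rw [← mul_eq_zero_of_right ((-1 : ℚ) ^ q) h3, Finset.mul_sum]
    refine Finset.sum_congr rfl fun k _ => ?_
    simp only [hf, shiftedChoose]
    rw [if_pos (by omega), Nat.add_sub_cancel_left, pow_add,
      show ((q + k : ℕ) : ℚ) - (c + 1) = (q : ℚ) - (c + 1) + k by push_cast; ring]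
    ring
  rw [show c + 1 + (b + 3) + a = q + (a + c + 3 + 1) + (b - q) by omega, hright] at hleft
  exact (mul_eq_zero.mp hleft.symm).resolve_left (by simp)

/-! ### MacMahon's determinant. -/

/-- Expresses multiplication by the unipotent Pascal matrix: these row operations make the upper
index grow with the row without changing the determinant. -/
theorem sum_choose_mul_shiftedChoose (n j : ℕ) : ∀ i m : ℕ,
    ∑ k ∈ Finset.range (i + 1), (i.choose k : ℚ) * shiftedChoose n (m + k) j =
      shiftedChoose (n + i) (m + i) j := by
  intro i
  induction i with
  | zero =>
    intro m
    simp
  | succ i ih =>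
    intro m
    rw [Finset.sum_choose_succ_mul (fun k _ => shiftedChoose n (m + k) j) i, ih m]
    have := ih (m + 1)
    simp_rw [show ∀ k, m + 1 + k = m + (k + 1) from fun k => by omega] at this
    rw [this, show m + (i + 1) = m + i + 1 by omega, show n + (i + 1) = n + i + 1 by omega,
      shiftedChoose_succ_succ, add_comm]

/-- After the row operations an entry splits into a row factor, a column factor and a monic
polynomial of degree `j` at `i + m`, which reduces the determinant to Vandermonde's. -/
theorem shiftedChoose_eq_mul_descPochhammer {n m : ℕ} (hmn : m ≤ n) (i j : ℕ) :
    shiftedChoose (n + i) (m + i) j =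
      ((n + i).factorial / (m + i).factorial : ℚ) *
        ((1 / (n - m + j).factorial : ℚ) * (descPochhammer ℚ j).eval ((i : ℚ) + m)) := by
  rw [show (i : ℚ) + m = ((m + i : ℕ) : ℚ) by push_cast; ring,
    descPochhammer_eval_eq_descFactorial, shiftedChoose]
  split_ifs with h
  · rw [Nat.cast_choose ℚ (show m + i - j ≤ n + i by omega),
      show n + i - (m + i - j) = n - m + j by omega]
    have := Nat.factorial_mul_descFactorial h
    have h2 : ((m + i - j).factorial : ℚ) * ((m + i).descFactorial j : ℚ) = (m + i).factorial := by
      exact_mod_cast this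
    rw [← h2]
    have h3 : ((m + i).descFactorial j : ℚ) ≠ 0 := by
      rw [Nat.cast_ne_zero, Ne, Nat.descFactorial_eq_zero_iff_lt]
      omega
    field_simp
  · rw [Nat.descFactorial_eq_zero_iff_lt.mpr (by omega)]
    simp

theorem det_vandermonde_natCast (b : ℕ) :
    (Matrix.vandermonde fun i : Fin b => ((i : ℕ) : ℚ)).det =
      ∏ i ∈ Finset.range b, (i.factorial : ℚ) := by
  cases b with
  | zero => simp
  | succ b =>
    rw [Matrix.det_vandermonde_id_eq_superFactorial]
    induction b with
    | zero => simp
    | succ b ih =>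
      rw [Nat.superFactorial, Finset.prod_range_succ, ← ih]
      push_cast
      ring

/-- MacMahon's determinant of binomial coefficients. -/
theorem det_shiftedChoose (b : ℕ) {n m : ℕ} (hmn : m ≤ n) :
    (Matrix.of fun i j : Fin b => shiftedChoose n (m + i) j).det =
      ∏ i ∈ Finset.range b, (i.factorial : ℚ) * (n + i).factorial /
        ((m + i).factorial * (n - m + i).factorial) := by
  set L : Matrix (Fin b) (Fin b) ℚ := Matrix.of fun i k => ((i : ℕ).choose k : ℚ) with hL
  have hLdet : L.det = 1 := by
    rw [Matrix.det_of_isLowerTriangular, Finset.prod_eq_one]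
    · intro i _
      simp [hL]
    · intro i k hik
      have hik' : (i : ℕ) < k := hik
      simp only [hL, Matrix.of_apply]
      rw [Nat.choose_eq_zero_of_lt hik', Nat.cast_zero]
  have hmul : L * (Matrix.of fun i j : Fin b => shiftedChoose n (m + i) j) =
      Matrix.of fun i j : Fin b => ((n + i).factorial / (m + i).factorial : ℚ) *
        (Matrix.of fun i j : Fin b => (1 / (n - m + j).factorial : ℚ) *
          (Matrix.of fun i j : Fin b => (descPochhammer ℚ j).eval ((i : ℚ) + m)) i j) i j := by
    ext i j
    simp only [Matrix.of_apply]
    rw [← shiftedChoose_eq_mul_descPochhammer hmn, ← sum_choose_mul_shiftedChoose, Matrix.mul_apply]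
    simp only [hL, Matrix.of_apply]
    rw [Fin.sum_univ_eq_sum_range
      (fun k => ((i : ℕ).choose k : ℚ) * shiftedChoose n (m + k) j) b]
    symm
    refine Finset.sum_subset (fun k hk => ?_) (fun k _ hk => ?_)
    · rw [Finset.mem_range] at hk ⊢
      omega
    · rw [Finset.mem_range] at hk
      rw [Nat.choose_eq_zero_of_lt (by omega), Nat.cast_zero, zero_mul]
  have hdet := congrArg Matrix.det hmul
  rw [Matrix.det_mul, hLdet, one_mul, Matrix.det_mul_column, Matrix.det_mul_row,
    ← Matrix.det_eval_matrixOfPolynomials_eq_det_vandermonde (fun i : Fin b => ((i : ℕ) : ℚ) + m)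
      (fun j => descPochhammer ℚ j) (fun j => descPochhammer_natDegree ℚ j)
      (fun j => monic_descPochhammer ℚ j), Matrix.det_vandermonde_add,
    det_vandermonde_natCast,
    Fin.prod_univ_eq_prod_range (fun i => ((n + i).factorial / (m + i).factorial : ℚ)) b,
    Fin.prod_univ_eq_prod_range (fun j => (1 / (n - m + j).factorial : ℚ)) b] at hdet
  rw [hdet, ← Finset.prod_mul_distrib, ← Finset.prod_mul_distrib]
  refine Finset.prod_congr rfl fun i _ => ?_
  field_simp

/-! ### Reduction to three exceptional columns. -/

/-- Left multiplication by the block matrix with rows `(A, B)` and `(0, 1)` clears the upper right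
block. -/
theorem det_mul_det_fromBlocks_of_annihilates {m n : Type*} [Fintype m] [Fintype n] [DecidableEq m]
    [DecidableEq n] (A : Matrix m m ℚ) (B : Matrix m n ℚ) (Q₁₁ : Matrix m m ℚ)
    (Q₁₂ : Matrix m n ℚ) (Q₂₁ : Matrix n m ℚ) (Q₂₂ : Matrix n n ℚ)
    (h : A * Q₁₂ + B * Q₂₂ = 0) :
    A.det * (Matrix.fromBlocks Q₁₁ Q₁₂ Q₂₁ Q₂₂).det = (A * Q₁₁ + B * Q₂₁).det * Q₂₂.det := by
  have := congrArg Matrix.det (Matrix.fromBlocks_multiply A B (0 : Matrix n m ℚ) (1 : Matrix n n ℚ)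
    Q₁₁ Q₁₂ Q₂₁ Q₂₂)
  rw [h, Matrix.det_mul, Matrix.det_fromBlocks_zero₂₁, Matrix.det_one, mul_one, Matrix.zero_mul,
    Matrix.zero_mul, Matrix.one_mul, Matrix.one_mul, zero_add, zero_add,
    Matrix.det_fromBlocks_zero₁₂] at this
  exact this

/-- The equivalence listing the first three elements of `Fin (b + 3)` separately. -/
def finThreeSumEquiv (b : ℕ) : Fin 3 ⊕ Fin b ≃ Fin (b + 3) :=
  finSumFinEquiv.trans (finCongr (add_comm 3 b))

theorem finThreeSumEquiv_inl (b : ℕ) (k : Fin 3) : (finThreeSumEquiv b (Sum.inl k) : ℕ) = k := by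
  simp [finThreeSumEquiv]

theorem finThreeSumEquiv_inr (b : ℕ) (j : Fin b) :
    (finThreeSumEquiv b (Sum.inr j) : ℕ) = 3 + j := by
  simp [finThreeSumEquiv, add_comm]

theorem sum_range_eq_sum_finThree (b : ℕ) (f : ℕ → ℚ) :
    ∑ y ∈ Finset.range (b + 3), f y = ∑ k : Fin 3, f k + ∑ j : Fin b, f (3 + j) := by
  rw [← Fin.sum_univ_eq_sum_range, ← (finThreeSumEquiv b).sum_comp, Fintype.sum_sum_type]
  simp only [finThreeSumEquiv_inl, finThreeSumEquiv_inr]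

/-- Bordering a matrix of `b + 3` rows with one row left out, and collecting its first and last
columns. -/
theorem det_succAbove_eq_det_fromBlocks (b s : ℕ) (hs : s < b + 3)
    (Z : ℕ → Fin (b + 2) → ℚ) :
    Matrix.det (fun p : Fin (b + 2) => Z ((⟨s, hs⟩ : Fin (b + 3)).succAbove p)) =
      (-1) ^ s * (-1) ^ b * (Matrix.fromBlocks
        (Matrix.of fun k l : Fin 3 =>
          (![if (k : ℕ) = s then 1 else 0, Z k 0, Z k (Fin.last (b + 1))] : Fin 3 → ℚ) l)
        (Matrix.of fun (k : Fin 3) (j : Fin b) => Z k j.castSucc.succ)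
        (Matrix.of fun (i : Fin b) (l : Fin 3) =>
          (![if 3 + (i : ℕ) = s then 1 else 0, Z (3 + i) 0, Z (3 + i) (Fin.last (b + 1))] :
            Fin 3 → ℚ) l)
        (Matrix.of fun i j : Fin b => Z (3 + i) j.castSucc.succ)).det := by
  set Q : Matrix (Fin (b + 3)) (Fin 3 ⊕ Fin b) ℚ := Matrix.of fun y l =>
    Sum.elim (![if (y : ℕ) = s then 1 else 0, Z y 0, Z y (Fin.last (b + 1))] : Fin 3 → ℚ)
      (fun j : Fin b => Z y j.castSucc.succ) l with hQ
  -- The cycle moves the last column to position `2`, past the `b` middle columns, hence the sign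
  -- `(-1) ^ b`.
  set κ : Equiv.Perm (Fin (b + 3)) := Fin.cycleIcc 2 (Fin.last (b + 2)) with hκ
  have h2 : ((2 : Fin (b + 3)) : ℕ) = 2 := rfl
  have hle : (2 : Fin (b + 3)) ≤ Fin.last (b + 2) := Fin.le_last _
  have hblocks : Matrix.fromBlocks
        (Matrix.of fun k l : Fin 3 =>
          (![if (k : ℕ) = s then 1 else 0, Z k 0, Z k (Fin.last (b + 1))] : Fin 3 → ℚ) l)
        (Matrix.of fun (k : Fin 3) (j : Fin b) => Z k j.castSucc.succ)
        (Matrix.of fun (i : Fin b) (l : Fin 3) =>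
          (![if 3 + (i : ℕ) = s then 1 else 0, Z (3 + i) 0, Z (3 + i) (Fin.last (b + 1))] :
            Fin 3 → ℚ) l)
        (Matrix.of fun i j : Fin b => Z (3 + i) j.castSucc.succ) =
      Q.submatrix (finThreeSumEquiv b) id := by
    ext i l
    rcases i with i | i <;> rcases l with l | l <;>
      simp [hQ, finThreeSumEquiv_inl, finThreeSumEquiv_inr]
  set Q' : Matrix (Fin (b + 3)) (Fin (b + 3)) ℚ := Matrix.of fun y =>
    (Fin.cons (if (y : ℕ) = s then 1 else 0) (Z y) : Fin (b + 3) → ℚ) with hQ'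
  have hcol : Q' = (Q.submatrix id (finThreeSumEquiv b).symm).submatrix id κ := by
    ext y l
    simp only [hQ', Matrix.of_apply, Matrix.submatrix_apply, id]
    have hinl : ∀ k : Fin 3, ∀ x : Fin (b + 3), (x : ℕ) = k →
        (finThreeSumEquiv b).symm x = Sum.inl k := fun k x h => by
      rw [Equiv.symm_apply_eq]
      exact Fin.ext (by rw [finThreeSumEquiv_inl, h])
    have hinr : ∀ j : Fin b, ∀ x : Fin (b + 3), (x : ℕ) = 3 + j →
        (finThreeSumEquiv b).symm x = Sum.inr j := fun k x h => by
      rw [Equiv.symm_apply_eq]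
      exact Fin.ext (by rw [finThreeSumEquiv_inr, h])
    induction l using Fin.cases with
    | zero =>
      rw [hκ, Fin.cycleIcc_of_lt (by rw [Fin.lt_def, h2]; simp), hinl 0 _ rfl]
      simp [hQ]
    | succ l =>
      induction l using Fin.lastCases with
      | last =>
        rw [Fin.succ_last, hκ, Fin.cycleIcc_of_last hle, hinl 2 _ rfl, ← Fin.succ_last,
          Fin.cons_succ]
        simp [hQ]
      | cast l =>
        rw [Fin.cons_succ]
        induction l using Fin.cases with
        | zero =>
          rw [hκ, Fin.cycleIcc_of_lt (by rw [Fin.lt_def, h2]; simp), hinl 1 _ rfl]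
          simp [hQ]
        | succ l =>
          have hlt : l.succ.castSucc.succ < Fin.last (b + 2) := by
            rw [Fin.lt_def]
            simp
          have hval : ((l.succ.castSucc.succ + 1 : Fin (b + 3)) : ℕ) = 3 + l := by
            rw [Fin.val_add_one_of_lt hlt]
            simp
            omega
          rw [hκ, Fin.cycleIcc_of_ge_of_lt (by rw [Fin.le_def, h2]; simp) hlt, hinr l _ hval]
          simp [hQ]
  have hdet : Q'.det = (-1) ^ b * (Q.submatrix (finThreeSumEquiv b) id).det := by
    rw [hcol, Matrix.det_permute', hκ, Fin.sign_cycleIcc_of_le hle,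
      ← Matrix.det_submatrix_equiv_self (finThreeSumEquiv b)]
    simp [Matrix.submatrix_submatrix, Function.comp_def]
    rfl
  rw [hblocks, mul_assoc, ← hdet, Matrix.det_succ_column_zero,
    Finset.sum_eq_single (⟨s, hs⟩ : Fin (b + 3))]
  · have hsign : ((-1 : ℚ) ^ s) * (-1) ^ s = 1 := by rw [← mul_pow]; simp
    simp only [hQ', Matrix.of_apply, Fin.cons_zero, if_true, mul_one, ← mul_assoc, hsign, one_mul]
    rfl
  · intro y _ hy
    have : (y : ℕ) ≠ s := fun h => hy (Fin.ext h)
    simp [hQ', this]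
  · simp

/-! ### Evaluation of the annihilating weights. -/

/-- The polynomial weights annihilating the two-sided path columns. -/
noncomputable def annihilatorWeight (a b c d y : ℕ) : ℚ :=
  (-1) ^ y * risingFactorial ((y : ℚ) + 1) (c + d) * risingFactorial ((b : ℚ) + 3 - y) a

theorem annihilatorWeight_one (a b c y : ℕ) :
    annihilatorWeight a b c 1 y = annihilatorWeight a b c 0 y * (c + 1 + y) := by
  simp only [annihilatorWeight, risingFactorial_succ_right, Nat.add_zero]
  ring

theorem annihilatorWeight_two (a b c y : ℕ) :
    annihilatorWeight a b c 2 y =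
      annihilatorWeight a b c 0 y * ((c + 1 + y) * (c + 2 + y)) := by
  simp only [annihilatorWeight, show c + 2 = c + 1 + 1 from rfl, risingFactorial_succ_right,
    Nat.add_zero]
  push_cast
  ring

/-- Writing the three binomials over a common factor keeps the cases `r = 0` and `r = 1` valid: the
polynomial cofactor vanishes where the binomial does. -/
theorem risingFactorial_mul_choose_add (b r : ℕ) :
    ((b + r).choose (b + 2) : ℚ) = risingFactorial ((r : ℚ) + 1) b / (b + 2).factorial *
        (r * (r - 1)) ∧
      ((b + r + 1).choose (b + 2) : ℚ) = risingFactorial ((r : ℚ) + 1) b / (b + 2).factorial *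
        (r * (b + r + 1)) ∧
      ((b + r + 2).choose (b + 2) : ℚ) = risingFactorial ((r : ℚ) + 1) b / (b + 2).factorial *
        ((b + r + 1) * (b + r + 2)) := by
  rw [risingFactorial_natCast_add_one, add_comm r b]
  refine ⟨?_, ?_, ?_⟩
  · rcases r with _ | _ | r
    · simp [Nat.choose_eq_zero_of_lt (show b < b + 2 by omega)]
    · simp
    · rw [Nat.cast_choose ℚ (show b + 2 ≤ b + (r + 1 + 1) by omega),
        show b + (r + 1 + 1) - (b + 2) = r by omega, Nat.factorial_succ (r + 1),
        Nat.factorial_succ r]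
      push_cast
      field_simp
      ring
  · rcases r with _ | r
    · simp
    · rw [Nat.cast_choose ℚ (show b + 2 ≤ b + (r + 1) + 1 by omega),
        show b + (r + 1) + 1 - (b + 2) = r by omega, Nat.factorial_succ (b + (r + 1)),
        Nat.factorial_succ r]
      push_cast
      field_simp
  · rw [Nat.cast_choose ℚ (show b + 2 ≤ b + r + 2 by omega),
      show b + r + 2 - (b + 2) = r by omega, Nat.factorial_succ (b + r + 1),
      Nat.factorial_succ (b + r)]
    push_cast
    field_simp
    ring

/-- The alternating sums evaluated by `sum_risingFactorial_mul_choose` for weights of length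
`e`, `e + 1` and `e + 2`. -/
theorem sum_risingFactorial_mul_choose_three (b c e r ρ : ℕ) (h : r + ρ = e + 2) :
    (∑ y ∈ Finset.range (b + 3), (-1) ^ y * risingFactorial ((y : ℚ) + 1) c *
        risingFactorial ((b : ℚ) + 3 - y) e * ((c + ρ).choose (c + y) : ℚ) =
      risingFactorial ((ρ : ℚ) + 1) c * (e.factorial * risingFactorial ((r : ℚ) + 1) b /
        (b + 2).factorial) * (r * (r - 1))) ∧
    (∑ y ∈ Finset.range (b + 3), (-1) ^ y * risingFactorial ((y : ℚ) + 1) c *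
        risingFactorial ((b : ℚ) + 3 - y) (e + 1) * ((c + ρ).choose (c + y) : ℚ) =
      risingFactorial ((ρ : ℚ) + 1) c * (e.factorial * risingFactorial ((r : ℚ) + 1) b /
        (b + 2).factorial) * ((e + 1) * r * (b + r + 1))) ∧
    (∑ y ∈ Finset.range (b + 3), (-1) ^ y * risingFactorial ((y : ℚ) + 1) c *
        risingFactorial ((b : ℚ) + 3 - y) (e + 2) * ((c + ρ).choose (c + y) : ℚ) =
      risingFactorial ((ρ : ℚ) + 1) c * (e.factorial * risingFactorial ((r : ℚ) + 1) b /
        (b + 2).factorial) * ((e + 1) * (e + 2) * (b + r + 1) * (b + r + 2))) := by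
  obtain ⟨h0, h1, h2⟩ := risingFactorial_mul_choose_add b r
  refine ⟨?_, ?_, ?_⟩
  · rw [sum_risingFactorial_mul_choose b c e ρ (by omega),
      show e + (b + 2) - ρ = b + r by omega, h0, risingFactorial_natCast_add_one ρ c, add_comm ρ c]
    ring
  · rw [sum_risingFactorial_mul_choose b c (e + 1) ρ (by omega),
      show e + 1 + (b + 2) - ρ = b + r + 1 by omega, h1, risingFactorial_natCast_add_one ρ c,
      add_comm ρ c, Nat.factorial_succ]
    push_cast
    ring
  · rw [sum_risingFactorial_mul_choose b c (e + 2) ρ (by omega),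
      show e + 2 + (b + 2) - ρ = b + r + 2 by omega, h2, risingFactorial_natCast_add_one ρ c,
      add_comm ρ c, Nat.factorial_succ, Nat.factorial_succ]
    push_cast
    ring

/-- Since `(c + 1 + y) + (b + 3 - y + a) = a + b + c + 4`, lengthening the first rising factorial
can be rewritten through lengthening the second, whose sums are known. -/
theorem sum_annihilatorWeight_mul_right (a b c r ρ : ℕ) (h : r + ρ = a + 2) (d : Fin 3) :
    ∑ y ∈ Finset.range (b + 3), annihilatorWeight a b c d y * ((c + ρ).choose (c + y) : ℚ) =
      risingFactorial ((ρ : ℚ) + 1) c * (a.factorial * risingFactorial ((r : ℚ) + 1) b /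
        (b + 2).factorial) * (![r * (r - 1),
          (a + b + c + 4) * (r * (r - 1)) - (a + 1) * r * (b + r + 1),
          (a + b + c + 4) * (a + b + c + 5) * (r * (r - 1)) -
            2 * (a + b + c + 5) * ((a + 1) * r * (b + r + 1)) +
            (a + 1) * (a + 2) * (b + r + 1) * (b + r + 2)] : Fin 3 → ℚ) d := by
  obtain ⟨h0, h1, h2⟩ := sum_risingFactorial_mul_choose_three b c a r ρ h
  fin_cases d
  · simpa [annihilatorWeight] using h0
  · simp only [Fin.mk_one, Matrix.cons_val_one, Matrix.cons_val_zero]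
    rw [mul_sub, ← h1, mul_left_comm, ← h0, Finset.mul_sum, ← Finset.sum_sub_distrib]
    refine Finset.sum_congr rfl fun y _ => ?_
    rw [annihilatorWeight_one, risingFactorial_succ_right, annihilatorWeight, Nat.add_zero]
    ring
  · simp only [Fin.reduceFinMk, Matrix.cons_val]
    rw [mul_add, mul_sub, ← h2, mul_left_comm, ← h0, mul_left_comm, ← h1, Finset.mul_sum,
      Finset.mul_sum, ← Finset.sum_sub_distrib, ← Finset.sum_add_distrib]
    refine Finset.sum_congr rfl fun y _ => ?_
    simp only [show a + 2 = a + 1 + 1 from rfl, risingFactorial_succ_right,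
      annihilatorWeight]
    push_cast
    ring

/-- The reflection `y ↦ b + 2 - y` exchanges the two rising factorials, at the cost of the sign
`(-1) ^ b`; the increment `d` then already sits on the second one. -/
theorem sum_annihilatorWeight_mul_left (a b c t τ : ℕ) (h : τ + t = c + 2) (d : Fin 3) :
    ∑ y ∈ Finset.range (b + 3),
        annihilatorWeight a b c d y * ((a + t).choose (a + (b + 2 - y)) : ℚ) =
      (-1) ^ b * (risingFactorial ((t : ℚ) + 1) a * (c.factorial *
        risingFactorial ((τ : ℚ) + 1) b / (b + 2).factorial)) * (![τ * (τ - 1),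
          (c + 1) * τ * (b + τ + 1),
          (c + 1) * (c + 2) * (b + τ + 1) * (b + τ + 2)] : Fin 3 → ℚ) d := by
  have hreflect : ∀ e : ℕ, ∑ y ∈ Finset.range (b + 3),
      annihilatorWeight a b c e y * ((a + t).choose (a + (b + 2 - y)) : ℚ) =
      (-1) ^ b * ∑ y ∈ Finset.range (b + 3), (-1) ^ y * risingFactorial ((y : ℚ) + 1) a *
        risingFactorial ((b : ℚ) + 3 - y) (c + e) * ((a + t).choose (a + y) : ℚ) := by
    intro e
    rw [← Finset.sum_range_reflect, Finset.mul_sum]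
    refine Finset.sum_congr rfl fun y hy => ?_
    rw [Finset.mem_range] at hy
    obtain ⟨z, hz⟩ : ∃ z, z + y = b + 2 := ⟨b + 2 - y, by omega⟩
    have hzq : (z : ℚ) + y = b + 2 := by exact_mod_cast hz
    rw [show b + 3 - 1 - y = z by omega, show b + 2 - z = y by omega, annihilatorWeight,
      show (b : ℚ) + 3 - z = y + 1 by linear_combination -hzq,
      show (b : ℚ) + 3 - y = z + 1 by linear_combination -hzq]
    have hsign : (-1 : ℚ) ^ z = (-1) ^ b * (-1) ^ y := by
      have h1 : (-1 : ℚ) ^ (z + y) = (-1) ^ (b + 2) := by rw [hz]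
      have h2 : ((-1 : ℚ) ^ y) * (-1) ^ y = 1 := by rw [← mul_pow]; simp
      rw [pow_add, pow_add] at h1
      linear_combination (-1 : ℚ) ^ y * h1 - (-1 : ℚ) ^ z * h2
    rw [hsign]
    ring
  obtain ⟨h0, h1, h2⟩ := sum_risingFactorial_mul_choose_three b a c τ t h
  rw [hreflect, mul_assoc]
  congr 1
  fin_cases d
  · simpa using h0
  · simpa using h1
  · simpa using h2

/-- Column `k` has the common factor `annihilatorWeight a b c 0 k`. The rest is a Vandermonde
determinant at three consecutive points, equal to `2`, which cancels the `2!` in the third factor.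
-/
theorem det_annihilatorWeight (a b c : ℕ) :
    (Matrix.of fun d k : Fin 3 => annihilatorWeight a b c d k).det =
      -((c.factorial : ℚ) * (c + 1).factorial * (c + 2).factorial *
        ((a + b + 2).factorial * (a + b + 1).factorial * (a + b).factorial) /
        ((b + 2).factorial * (b + 1).factorial * b.factorial)) := by
  have h0 : annihilatorWeight a b c 0 0 =
      (c.factorial : ℚ) * ((a + b + 2).factorial / (b + 2).factorial) := by
    rw [annihilatorWeight, risingFactorial_natCast_add_one,
      show (b : ℚ) + 3 - (0 : ℕ) = ((b + 2 : ℕ) : ℚ) + 1 by push_cast; ring,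
      risingFactorial_natCast_add_one, show b + 2 + a = a + b + 2 by omega]
    simp
  have h1 : annihilatorWeight a b c 0 1 =
      -(((c + 1).factorial : ℚ) * ((a + b + 1).factorial / (b + 1).factorial)) := by
    rw [annihilatorWeight, risingFactorial_natCast_add_one,
      show (b : ℚ) + 3 - (1 : ℕ) = ((b + 1 : ℕ) : ℚ) + 1 by push_cast; ring,
      risingFactorial_natCast_add_one, show b + 1 + a = a + b + 1 by omega,
      show 1 + (c + 0) = c + 1 by omega]
    simp
  have h2 : annihilatorWeight a b c 0 2 =
      ((c + 2).factorial : ℚ) / 2 * ((a + b).factorial / b.factorial) := by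
    rw [annihilatorWeight, risingFactorial_natCast_add_one,
      show (b : ℚ) + 3 - (2 : ℕ) = ((b : ℕ) : ℚ) + 1 by push_cast; ring,
      risingFactorial_natCast_add_one, add_comm b a, show 2 + (c + 0) = c + 2 by omega]
    simp
  rw [Matrix.det_fin_three]
  simp only [Matrix.of_apply, Fin.val_zero, Fin.val_one, Fin.val_two, annihilatorWeight_one,
    annihilatorWeight_two, h0, h1, h2]
  push_cast
  ring

/-! ### Factorial products and the final assembly. -/

theorem prod_range_factorial_add (m b : ℕ) :
    ∏ i ∈ Finset.range b, ((m + i).factorial : ℚ) =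
      (∏ i ∈ Finset.range (m + b), (i.factorial : ℚ)) / ∏ i ∈ Finset.range m, (i.factorial : ℚ) := by
  have hne : ∏ i ∈ Finset.range m, (i.factorial : ℚ) ≠ 0 :=
    Finset.prod_ne_zero_iff.mpr fun i _ => by positivity
  rw [eq_div_iff hne, Finset.prod_range_add, mul_comm]

theorem prod_factorials_ratio (a b c : ℕ) :
    (∏ i ∈ Finset.range b, (i.factorial : ℚ) * (a + c + 3 + i).factorial /
        ((c + 3 + i).factorial * (a + i).factorial)) *
      (a.factorial * c.factorial * (b + 2) / ((b + 2).factorial * (b + 2).factorial)) =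
    ((prodFactorials a * prodFactorials b * prodFactorials c * prodFactorials (a + b + c + 2)) /
        (prodFactorials (b + c + 2) * prodFactorials (a + c + 2) * prodFactorials (a + b + 2))) *
      ((c.factorial : ℚ) * (c + 1).factorial * (c + 2).factorial *
        ((a + b + 2).factorial * (a + b + 1).factorial * (a + b).factorial) /
        ((b + 2).factorial * (b + 1).factorial * b.factorial)) := by
  have hne : ∀ m, ∏ i ∈ Finset.range m, (i.factorial : ℚ) ≠ 0 := fun m =>
    Finset.prod_ne_zero_iff.mpr fun i _ => by positivity
  rw [Finset.prod_div_distrib, Finset.prod_mul_distrib, Finset.prod_mul_distrib,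
    prod_range_factorial_add, prod_range_factorial_add, prod_range_factorial_add]
  simp only [prodFactorials]
  rw [show a + c + 3 + b = a + b + c + 2 + 1 by omega, show c + 3 + b = b + c + 2 + 1 by omega,
    show a + c + 3 = a + c + 2 + 1 by omega,
    Finset.prod_range_succ _ (a + b + 2), Finset.prod_range_succ _ (a + b + 1),
    Finset.prod_range_succ _ (a + b), Finset.prod_range_succ _ (c + 2),
    Finset.prod_range_succ _ (c + 1), Finset.prod_range_succ _ a, Finset.prod_range_succ _ b]
  have hb : ((b + 2).factorial : ℚ) = (b + 2) * (b + 1).factorial := by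
    rw [Nat.factorial_succ (b + 1)]
    push_cast
    ring
  rw [hb]
  have h1 := hne (a + b + c + 2 + 1)
  have h2 := hne (b + c + 2 + 1)
  have h3 := hne (a + c + 2 + 1)
  have h4 := hne (a + b)
  have h5 := hne (c + 1)
  have h6 := hne a
  have h7 := hne b
  field_simp

theorem pathVector_zero_eq {a b c r ρ T y : ℕ} (h : r + ρ = a + 2) (hy : y ≤ b + 2) :
    pathVector b r T (a + b + 4 - y) (a + c + 3) 0 = ((c + ρ).choose (c + y) : ℚ) := by
  rw [pathVector, if_pos (by simp), show a + c + 3 - r - 1 = c + ρ by omega,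
    shiftedChoose_symm (show a + b + 4 - y + (c + y) = c + ρ + (b + 2 + r) + 0 by omega),
    shiftedChoose, if_pos (Nat.zero_le _), Nat.sub_zero]

theorem pathVector_last_eq {a b c r t y : ℕ} (ht : t ≤ c + 2) (hy : y ≤ b + 2) :
    pathVector b r (c + 2 - t) (a + b + 4 - y) (a + c + 3) (Fin.last (b + 1)) =
      ((a + t).choose (a + (b + 2 - y)) : ℚ) := by
  rw [pathVector, if_neg (by simp), if_pos (by simp), cornerPaths, if_pos (by omega),
    show a + c + 3 - (c + 2 - t) - 1 = a + t by omega, shiftedChoose, if_pos (by omega),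
    show a + b + 4 - y - 2 = a + (b + 2 - y) by omega]

theorem pathVector_middle_eq {a b c r T y : ℕ} (hy : y ≤ b + 2) (j : Fin b) :
    pathVector b r T (a + b + 4 - y) (a + c + 3) j.castSucc.succ =
      shiftedChoose (a + c + 3) (c + 1 + y) (j + 1) := by
  have := j.2
  rw [pathVector, if_neg (by simp), if_neg (by simp; omega)]
  refine shiftedChoose_symm ?_
  simp only [Fin.val_succ, Fin.val_castSucc]
  omega

/-- The `3 × 3` determinant of the reduced boundary data. -/
theorem det_boundaryData_eq (a b c r s t τ : ℚ) (hτ : τ = c + 2 - t) :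
    ((a + b + c + 4) * (r * (r - 1)) - (a + 1) * r * (b + r + 1)) *
        ((c + 1) * (c + 2) * (b + τ + 1) * (b + τ + 2)) -
      ((c + 1) * τ * (b + τ + 1)) *
        ((a + b + c + 4) * (a + b + c + 5) * (r * (r - 1)) -
          2 * (a + b + c + 5) * ((a + 1) * r * (b + r + 1)) +
          (a + 1) * (a + 2) * (b + r + 1) * (b + r + 2)) -
      (r * (r - 1)) * (c + 1 + s) * ((c + 1) * (c + 2) * (b + τ + 1) * (b + τ + 2)) +
      (r * (r - 1)) * ((c + 1) * τ * (b + τ + 1)) * ((c + 1 + s) * (c + 2 + s)) +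
      (τ * (τ - 1)) * (c + 1 + s) *
        ((a + b + c + 4) * (a + b + c + 5) * (r * (r - 1)) -
          2 * (a + b + c + 5) * ((a + 1) * r * (b + r + 1)) +
          (a + 1) * (a + 2) * (b + r + 1) * (b + r + 2)) -
      (τ * (τ - 1)) * ((a + b + c + 4) * (r * (r - 1)) - (a + 1) * r * (b + r + 1)) *
        ((c + 1 + s) * (c + 2 + s)) =
    -(b + 2) * ((a + 1) * (b + 1) * (c + 1) * (a + 2 - r) * (b + 2 - s) * (c + 2 - t)
        + (a + 1) * (b + 1) * (c + 1) * r * s * t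
        - (a + 2 - r) * (b + 2 - s) * (c + 2 - t) * r * s * t
        + (a + 1) * (c + 1) * (b + 2 - s) * (c + 2 - t) * r * s
        + (b + 1) * (a + 1) * (c + 2 - t) * (a + 2 - r) * s * t
        + (c + 1) * (b + 1) * (a + 2 - r) * (b + 2 - s) * t * r) := by
  subst hτ
  ring

theorem corollary3 (a b c r s t : ℕ) (hr : r ≤ a + 2) (hs : s ≤ b + 2) (ht : t ≤ c + 2) :
    (Nat.card {P : PlanePartition (a + 2) (b + 2) (c + 2) //
        (Finset.univ.filter fun j : Fin (b + 2) => P.entry 0 j = c + 2).card = b + 2 - s ∧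
        (Finset.univ.filter fun i : Fin (a + 2) => P.entry i (Fin.last (b + 1)) = 0).card = r ∧
        P.entry (Fin.last (a + 1)) 0 = c + 2 - t} : ℚ) =
      risingFactorial ((r : ℚ) + 1) b * risingFactorial ((s : ℚ) + 1) c *
        risingFactorial ((t : ℚ) + 1) a * risingFactorial ((c : ℚ) + 3 - t) b *
        risingFactorial ((a : ℚ) + 3 - r) c * risingFactorial ((b : ℚ) + 3 - s) a *
      ((prodFactorials a * prodFactorials b * prodFactorials c * prodFactorials (a + b + c + 2)) /
        (prodFactorials (b + c + 2) * prodFactorials (a + c + 2) * prodFactorials (a + b + 2))) *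
      (((a : ℚ) + 1) * (b + 1) * (c + 1) * (a + 2 - r) * (b + 2 - s) * (c + 2 - t)
        + ((a : ℚ) + 1) * (b + 1) * (c + 1) * r * s * t
        - ((a : ℚ) + 2 - r) * (b + 2 - s) * (c + 2 - t) * r * s * t
        + ((a : ℚ) + 1) * (c + 1) * (b + 2 - s) * (c + 2 - t) * r * s
        + ((b : ℚ) + 1) * (a + 1) * (c + 2 - t) * (a + 2 - r) * s * t
        + ((c : ℚ) + 1) * (b + 1) * (a + 2 - r) * (b + 2 - s) * t * r) := by
  obtain ⟨ρ, hρ⟩ : ∃ ρ, r + ρ = a + 2 := ⟨a + 2 - r, by omega⟩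
  obtain ⟨τ, hτ⟩ : ∃ τ, τ + t = c + 2 := ⟨c + 2 - t, by omega⟩
  have hρq : (r : ℚ) + ρ = a + 2 := by exact_mod_cast hρ
  have hτq : (τ : ℚ) + t = c + 2 := by exact_mod_cast hτ
  rw [card_planePartition_eq_det a b c r s t hr (by omega),
    det_succAbove_eq_det_fromBlocks b s (by omega)
      (fun y => pathVector b r (c + 2 - t) (a + b + 4 - y) (a + c + 3))]
  set Z : ℕ → Fin (b + 2) → ℚ :=
    fun y => pathVector b r (c + 2 - t) (a + b + 4 - y) (a + c + 3) with hZ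
  have hZ0 : ∀ y, y < b + 3 → Z y 0 = ((c + ρ).choose (c + y) : ℚ) := fun y hy =>
    pathVector_zero_eq hρ (by omega)
  have hZl : ∀ y, y < b + 3 → Z y (Fin.last (b + 1)) =
      ((a + t).choose (a + (b + 2 - y)) : ℚ) := fun y hy => pathVector_last_eq ht (by omega)
  have hZm : ∀ y, y < b + 3 → ∀ j : Fin b, Z y j.castSucc.succ =
      shiftedChoose (a + c + 3) (c + 1 + y) (j + 1) := fun y hy j =>
    pathVector_middle_eq (by omega) j
  -- The block `(A, B)` holds the three weights on all `b + 3` rows; it annihilates the middle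
  -- columns.
  have key := det_mul_det_fromBlocks_of_annihilates
    (Matrix.of fun d k : Fin 3 => annihilatorWeight a b c d k)
    (Matrix.of fun (d : Fin 3) (j : Fin b) => annihilatorWeight a b c d (3 + j))
    (Matrix.of fun k l : Fin 3 =>
      (![if (k : ℕ) = s then 1 else 0, Z k 0, Z k (Fin.last (b + 1))] : Fin 3 → ℚ) l)
    (Matrix.of fun (k : Fin 3) (j : Fin b) => Z k j.castSucc.succ)
    (Matrix.of fun (i : Fin b) (l : Fin 3) =>
      (![if 3 + (i : ℕ) = s then 1 else 0, Z (3 + i) 0, Z (3 + i) (Fin.last (b + 1))] :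
        Fin 3 → ℚ) l)
    (Matrix.of fun i j : Fin b => Z (3 + i) j.castSucc.succ)
    (by
      ext d j
      have hd := d.2
      have hj := j.2
      have h := sum_risingFactorial_mul_shiftedChoose a b c d (j + 1) (by omega) (by omega)
        (by omega)
      simp only [Matrix.add_apply, Matrix.mul_apply, Matrix.of_apply, Matrix.zero_apply]
      rw [← sum_range_eq_sum_finThree b
        (fun y => annihilatorWeight a b c d y * Z y j.castSucc.succ), ← h]
      refine Finset.sum_congr rfl fun y hy => ?_
      rw [hZm y (Finset.mem_range.mp hy), annihilatorWeight])
  set D := (Matrix.fromBlocks _ _ _ _ : Matrix (Fin 3 ⊕ Fin b) (Fin 3 ⊕ Fin b) ℚ).det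
  have hmid : (Matrix.of fun i j : Fin b => Z (3 + i) j.castSucc.succ).det =
      ∏ i ∈ Finset.range b, (i.factorial : ℚ) * (a + c + 3 + i).factorial /
        ((c + 3 + i).factorial * (a + i).factorial) := by
    have h := det_shiftedChoose b (show c + 3 ≤ a + c + 3 by omega)
    rw [show a + c + 3 - (c + 3) = a by omega] at h
    rw [← h]
    congr 1
    ext i j
    have := i.2
    simp only [Matrix.of_apply]
    rw [hZm _ (by omega)]
    unfold shiftedChoose
    rw [show c + 1 + (3 + (i : ℕ)) = c + 3 + i + 1 by omega]
    simp only [Nat.add_le_add_iff_right, Nat.add_sub_add_right]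
  have hsmall : (Matrix.of fun d k : Fin 3 => annihilatorWeight a b c d k) *
        (Matrix.of fun k l : Fin 3 =>
          (![if (k : ℕ) = s then 1 else 0, Z k 0, Z k (Fin.last (b + 1))] : Fin 3 → ℚ) l) +
      (Matrix.of fun (d : Fin 3) (j : Fin b) => annihilatorWeight a b c d (3 + j)) *
        (Matrix.of fun (i : Fin b) (l : Fin 3) =>
          (![if 3 + (i : ℕ) = s then 1 else 0, Z (3 + i) 0, Z (3 + i) (Fin.last (b + 1))] :
            Fin 3 → ℚ) l) =
      Matrix.of fun d l : Fin 3 => (![annihilatorWeight a b c d s,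
        ∑ y ∈ Finset.range (b + 3), annihilatorWeight a b c d y * ((c + ρ).choose (c + y) : ℚ),
        ∑ y ∈ Finset.range (b + 3),
          annihilatorWeight a b c d y * ((a + t).choose (a + (b + 2 - y)) : ℚ)] : Fin 3 → ℚ) l := by
    ext d l
    simp only [Matrix.add_apply, Matrix.mul_apply, Matrix.of_apply]
    fin_cases l
    · simp only [Fin.zero_eta, Matrix.cons_val_zero]
      rw [← sum_range_eq_sum_finThree b
        (fun y => annihilatorWeight a b c d y * if y = s then 1 else 0)]
      simp only [mul_ite, mul_one, mul_zero, Finset.sum_ite_eq', Finset.mem_range]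
      rw [if_pos (by omega)]
    · simp only [Fin.mk_one, Matrix.cons_val_one, Matrix.cons_val_zero]
      rw [← sum_range_eq_sum_finThree b (fun y => annihilatorWeight a b c d y * Z y 0)]
      exact Finset.sum_congr rfl fun y hy => by rw [hZ0 y (Finset.mem_range.mp hy)]
    · simp only [Fin.reduceFinMk, Matrix.cons_val]
      rw [← sum_range_eq_sum_finThree b
        (fun y => annihilatorWeight a b c d y * Z y (Fin.last (b + 1)))]
      exact Finset.sum_congr rfl fun y hy => by rw [hZl y (Finset.mem_range.mp hy)]
  rw [hsmall, hmid, det_annihilatorWeight, Matrix.det_fin_three] at key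
  simp only [Matrix.of_apply, sum_annihilatorWeight_mul_right a b c r ρ hρ,
    sum_annihilatorWeight_mul_left a b c t τ hτ, Matrix.cons_val, Fin.val_zero, Fin.val_one,
    Fin.val_two, annihilatorWeight_one, annihilatorWeight_two] at key
  have hratio := prod_factorials_ratio a b c
  have hs2 : ((-1 : ℚ) ^ s) * (-1) ^ s = 1 := by rw [← mul_pow]; simp
  have hb2 : ((-1 : ℚ) ^ b) * (-1) ^ b = 1 := by rw [← mul_pow]; simp
  have hw : annihilatorWeight a b c 0 s = (-1) ^ s * (risingFactorial ((s : ℚ) + 1) c *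
      risingFactorial ((b : ℚ) + 3 - s) a) := by
    rw [annihilatorWeight, Nat.add_zero, mul_assoc]
  rw [hw] at key
  rw [show (c : ℚ) + 3 - t = τ + 1 by linear_combination -hτq,
    show (a : ℚ) + 3 - r = ρ + 1 by linear_combination -hρq]
  have hpoly := det_boundaryData_eq a b c r s t τ (by linear_combination hτq)
  set poly : ℚ := ((a : ℚ) + 1) * (b + 1) * (c + 1) * (a + 2 - r) * (b + 2 - s) * (c + 2 - t)
        + ((a : ℚ) + 1) * (b + 1) * (c + 1) * r * s * t
        - ((a : ℚ) + 2 - r) * (b + 2 - s) * (c + 2 - t) * r * s * t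
        + ((a : ℚ) + 1) * (c + 1) * (b + 2 - s) * (c + 2 - t) * r * s
        + ((b : ℚ) + 1) * (a + 1) * (c + 2 - t) * (a + 2 - r) * s * t
        + ((c : ℚ) + 1) * (b + 1) * (a + 2 - r) * (b + 2 - s) * t * r
  set V : ℚ := (c.factorial : ℚ) * (c + 1).factorial * (c + 2).factorial *
        ((a + b + 2).factorial * (a + b + 1).factorial * (a + b).factorial) /
        ((b + 2).factorial * (b + 1).factorial * b.factorial) with hV
  -- `-V` is the determinant of the weights on the first three rows, so `V` may be cancelled at the
  -- end.
  have hVne : V ≠ 0 := by rw [hV]; positivity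
  set X := ∏ i ∈ Finset.range b, (i.factorial : ℚ) * (a + c + 3 + i).factorial /
        ((c + 3 + i).factorial * (a + i).factorial)
  set W := risingFactorial ((r : ℚ) + 1) b * risingFactorial ((s : ℚ) + 1) c *
        risingFactorial ((t : ℚ) + 1) a * risingFactorial ((τ : ℚ) + 1) b *
        risingFactorial ((ρ : ℚ) + 1) c * risingFactorial ((b : ℚ) + 3 - s) a with hW
  have key' : V * D = (-1) ^ s * (-1) ^ b * W * poly *
      (X * (a.factorial * c.factorial * (b + 2) / ((b + 2).factorial * (b + 2).factorial))) := by
    rw [hW]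
    linear_combination -key - (-1) ^ s * (-1) ^ b * (risingFactorial ((r : ℚ) + 1) b *
      risingFactorial ((s : ℚ) + 1) c * risingFactorial ((t : ℚ) + 1) a *
      risingFactorial ((τ : ℚ) + 1) b * risingFactorial ((ρ : ℚ) + 1) c *
      risingFactorial ((b : ℚ) + 3 - s) a) * (X * (a.factorial * c.factorial /
        ((b + 2).factorial * (b + 2).factorial))) * hpoly
  rw [hratio] at key'
  refine mul_left_cancel₀ hVne ?_
  have hsb : ((-1 : ℚ) ^ s * (-1) ^ b) * ((-1) ^ s * (-1) ^ b) = 1 := by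
    rw [mul_mul_mul_comm, hs2, hb2, one_mul]
  linear_combination (-1) ^ s * (-1) ^ b * key' + W * poly * (prodFactorials a *
    prodFactorials b * prodFactorials c * prodFactorials (a + b + c + 2) /
    (prodFactorials (b + c + 2) * prodFactorials (a + c + 2) * prodFactorials (a + b + 2))) * V *
    hsb
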